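/- For an angle $\theta$ let $R_x^\theta, R_y^\theta, R_z^\theta\in SO(3)$ be the rotations by $\theta$ about the coordinate axes. For positive integers $p,q$ let $G(p,q)\subset SO(3)$ be the subgroup generated by $A=R_x^{2\pi/p}$ and $C=R_z^{2\pi/q}$, and let $\hat G(p,q)\subset SO(3)$ be the subgroup generated by $R_x^{2\pi/p}$ and $R_y^{2\pi/q}$. Let $\mathbb Z_n$ be the cyclic group of order $n$, let $D_n$ be the dihedral group of order $2n$, and let $[p,q]$ be the least common multiple of $p$ and $q$. In the presentations below, the generators $\alpha,\beta$ correspond to $A,C$. 1. If $p$ and $q$ are both odd, then $G(p,q)=\langle\alpha,\beta:\alpha^p,\beta^q\rangle=\mathbb Z_p*\mathbb Z_q$, where the factors are generated by $A$ and by $C$. 2. If $p$ is even and $q$ is odd, then $G(p,q)=\langle\alpha,\beta:\alpha^p,\beta^q,(\alpha^{p/2}\beta)^2\rangle=\mathbb Z_p*_{\mathbb Z_2}D_q$, where $\mathbb Z_p$ is generated by $A$, $D_q$ by the rotation $C$ and the reflection $A^{p/2}$, and the amalgamated $\mathbb Z_2$ by $A^{p/2}$. 3. If $p$ and $q$ are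 both even and $4\nmid q$, then $G(p,q)=\langle\alpha,\beta:\alpha^p,\beta^q,(\alpha^{p/2}\beta)^2,(\alpha\beta^{q/2})^2\rangle=D_p*_{D_2}D_q$, where $D_p$ is generated by the rotation $A$ and the reflection $C^{q/2}$, $D_q$ by the rotation $C$ and the reflection $A^{p/2}$, and the amalgamated $D_2$ by $A^{p/2}$ and $C^{q/2}$. 4. If $4$ divides both $p$ and $q$, then $G(p,q)=\hat G([p,q],4)$, as subgroups of $SO(3)$. Here "rotation" and "reflection" generators of $D_n$ mean the standard generators $a_1,a_2$ in $D_n=\langle a_1,a_2:a_1^n,a_2^2,(a_1a_2)^2\rangle$. -/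

import Mathlib

/-- The group `SO(3)` of rotations of Euclidean three-space. -/
abbrev SO3 : Type := Matrix.specialOrthogonalGroup (Fin 3) ℝ

/-- Rotation by the angle `θ` about the `x`-axis. -/
noncomputable def rotX (θ : ℝ) : SO3 :=
  ⟨!![1, 0, 0; 0, Real.cos θ, -Real.sin θ; 0, Real.sin θ, Real.cos θ], by
    rw [Matrix.mem_specialOrthogonalGroup_iff, Matrix.mem_orthogonalGroup_iff]
    have h := Real.sin_sq_add_cos_sq θ
    refine ⟨?_, ?_⟩
    · ext i j
      fin_cases i <;> fin_cases j <;>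
        simp [Matrix.mul_apply, Fin.sum_univ_three, Matrix.star_eq_conjTranspose] <;> linarith
    · simp [Matrix.det_fin_three]
      linarith⟩

/-- Rotation by the angle `θ` about the `y`-axis. -/
noncomputable def rotY (θ : ℝ) : SO3 :=
  ⟨!![Real.cos θ, 0, Real.sin θ; 0, 1, 0; -Real.sin θ, 0, Real.cos θ], by
    rw [Matrix.mem_specialOrthogonalGroup_iff, Matrix.mem_orthogonalGroup_iff]
    have h := Real.sin_sq_add_cos_sq θ
    refine ⟨?_, ?_⟩
    · ext i j
      fin_cases i <;> fin_cases j <;>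
        simp [Matrix.mul_apply, Fin.sum_univ_three, Matrix.star_eq_conjTranspose] <;> linarith
    · simp [Matrix.det_fin_three]
      linarith⟩

/-- Rotation by the angle `θ` about the `z`-axis. -/
noncomputable def rotZ (θ : ℝ) : SO3 :=
  ⟨!![Real.cos θ, -Real.sin θ, 0; Real.sin θ, Real.cos θ, 0; 0, 0, 1], by
    rw [Matrix.mem_specialOrthogonalGroup_iff, Matrix.mem_orthogonalGroup_iff]
    have h := Real.sin_sq_add_cos_sq θ
    refine ⟨?_, ?_⟩
    · ext i j
      fin_cases i <;> fin_cases j <;>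
        simp [Matrix.mul_apply, Fin.sum_univ_three, Matrix.star_eq_conjTranspose] <;> linarith
    · simp [Matrix.det_fin_three]
      linarith⟩

/-- `G(p,q)`: the subgroup of `SO(3)` generated by the rotation by `2π/p` about the `x`-axis
and the rotation by `2π/q` about the `z`-axis. -/
noncomputable def GGroup (p q : ℕ) : Subgroup SO3 :=
  Subgroup.closure {rotX (2 * Real.pi / p), rotZ (2 * Real.pi / q)}

/-- `Ĝ(p,q)`: the subgroup of `SO(3)` generated by the rotation by `2π/p` about the `x`-axis
and the rotation by `2π/q` about the `y`-axis. -/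
noncomputable def GHat (p q : ℕ) : Subgroup SO3 :=
  Subgroup.closure {rotX (2 * Real.pi / p), rotY (2 * Real.pi / q)}

/-- The free generator `α`. -/
def genα : FreeGroup (Fin 2) := FreeGroup.of 0

/-- The free generator `β`. -/
def genβ : FreeGroup (Fin 2) := FreeGroup.of 1

/-- The group `G ≤ SO(3)` has the presentation `⟨α, β : rels⟩`, where the generators `α`, `β`
correspond to the elements `a`, `b` of `G`. -/
def HasPresentation (G : Subgroup SO3) (a b : SO3) (rels : Set (FreeGroup (Fin 2))) : Prop :=
  ∃ e : PresentedGroup rels ≃* G,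
    (e (PresentedGroup.of 0) : SO3) = a ∧ (e (PresentedGroup.of 1) : SO3) = b

/-- The cyclic group `ℤ_n`, written multiplicatively. -/
abbrev Cyc (n : ℕ) : Type := Multiplicative (ZMod n)

/-- The standard generator of `ℤ_n`. -/
def cycGen (n : ℕ) : Cyc n := Multiplicative.ofAdd 1

universe u v

/-- The two-member family of types consisting of `K` and `L`. -/
def AmalgFactor (K L : Type u) : Bool → Type u
  | false => K
  | true => L

instance (K L : Type u) [Group K] [Group L] : ∀ i, Group (AmalgFactor K L i)
  | false => inferInstanceAs (Group K)
  | true => inferInstanceAs (Group L)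

/-- A pair of homomorphisms from `H`, as a family. -/
def amalgHom {H : Type v} {K L : Type u} [Group H] [Group K] [Group L]
    (φ : H →* K) (ψ : H →* L) : ∀ i, H →* AmalgFactor K L i
  | false => φ
  | true => ψ

/-- The pushout of `φ : H →* K` and `ψ : H →* L`; when `φ` and `ψ` are injective this is the
amalgamated free product `K *_H L`. -/
abbrev Amalgam {H : Type v} {K L : Type u} [Group H] [Group K] [Group L]
    (φ : H →* K) (ψ : H →* L) : Type (max u v) :=
  Monoid.PushoutI (amalgHom φ ψ)

/-- The canonical map of the first factor into the amalgamated product. -/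
def Amalgam.inl {H : Type v} {K L : Type u} [Group H] [Group K] [Group L]
    (φ : H →* K) (ψ : H →* L) : K →* Amalgam φ ψ :=
  Monoid.PushoutI.of (φ := amalgHom φ ψ) false

/-- The canonical map of the second factor into the amalgamated product. -/
def Amalgam.inr {H : Type v} {K L : Type u} [Group H] [Group K] [Group L]
    (φ : H →* K) (ψ : H →* L) : L →* Amalgam φ ψ :=
  Monoid.PushoutI.of (φ := amalgHom φ ψ) true

/-! The presentations come from a 2-adic ping-pong argument. Extend the 2-adic absolute value to a
valuation `V` of ℂ, so `V 2 < 1`, and restrict it to ℝ. Modulo 2 signs disappear, so half turns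
about the axes reduce to the identity. Let θ have finite order, with ζ = exp(iθ) and ζ² ≠ 1. If ζ² =
-1, the rotation reduces to a permutation matrix. Otherwise cos θ is larger than 1 and sin θ agrees
with it to leading order (`cos_eq_zero_or_one_lt`), so dividing the matrix by cos θ leaves a
rank-one residue.

Such residues about the x-axis and the z-axis send each other's image directions to nonzero vectors.
An alternating word therefore enlarges a suitable test vector, or is a single quarter turn about x,
and is never the identity modulo 2 (`not_nearMat_prod`). Quarter turns can be tolerated about one
axis only, since they cause no growth; this is why 4 ∤ q is needed.

In each of the first three cases, the elements of a factor outside the amalgamated subgroup act as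
such letters, and the amalgamated subgroup acts trivially modulo 2. The normal form in a pushout
then makes the map to SO(3) injective (`Amalgam.injective_of_isLetter`). The presentation follows
because the presented group maps to the amalgam with a left inverse
(`hasPresentation_of_injective`).

When 4 divides both p and q, quarter turns about all axes are available. They conjugate the axes
into each other, and Bézout's identity combines the angles. -/

theorem exists_valuationSubring_two_lt_one :
    ∃ B : ValuationSubring ℂ, B.valuation 2 < 1 := by
  let A : Subring ℂ := (Int.castRingHom ℂ).range
  let t : A := ⟨2, 2, by simp⟩
  have ht : Ideal.span {t} ≠ ⊤ := by
    rw [Ne, Ideal.span_singleton_eq_top, isUnit_iff_exists_inv]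
    rintro ⟨⟨_, n, rfl⟩, h⟩
    have h1 : (2 : ℂ) * (n : ℂ) = 1 := congrArg Subtype.val h
    have h2 : (2 * n : ℤ) = 1 := by exact_mod_cast h1
    omega
  -- Chevalley's extension theorem: a proper ideal of a subring of a field lies in the nonunits of
  -- some valuation ring of the field.
  obtain ⟨B, -, hB⟩ := Ideal.image_subset_nonunits_valuationSubring (Ideal.span {t}) ht
  refine ⟨B, ?_⟩
  have := hB ⟨t, Ideal.subset_span rfl, rfl⟩
  exact this

/-! ### Roots of unity and cosines under a valuation above 2. -/

section Valuation

variable {Γ : Type*} [LinearOrderedCommGroupWithZero Γ]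

theorem Valuation.map_eq_one_of_pow_eq_one {R : Type*} [Ring R] (V : Valuation R Γ) {x : R}
    {n : ℕ} (hn : n ≠ 0) (h : x ^ n = 1) : V x = 1 := by
  have : V x ^ n = 1 := by rw [← map_pow, h, map_one]
  exact (pow_eq_one_iff_of_nonneg zero_le hn).1 this

theorem Valuation.map_natCast_le_one {R : Type*} [Ring R] (V : Valuation R Γ) (n : ℕ) :
    V (n : R) ≤ 1 := by
  induction n with
  | zero => simp
  | succ n ih => push_cast; exact V.map_add_le ih (by simp)

theorem Valuation.map_odd_natCast {R : Type*} [Ring R] (V : Valuation R Γ) (h2 : V 2 < 1)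
    {n : ℕ} (hn : Odd n) : V (n : R) = 1 := by
  obtain ⟨k, rfl⟩ := hn
  have : V ((2 : R) * k) < V 1 := by
    rw [map_mul, map_one]
    exact mul_lt_one_of_lt_of_le h2 (V.map_natCast_le_one k)
  push_cast
  rw [Valuation.map_add_eq_of_lt_right V this, map_one]

theorem Valuation.map_geom_sum_le_one {R : Type*} [Ring R] (V : Valuation R Γ) {x : R}
    (hx : V x ≤ 1) (n : ℕ) : V (∑ i ∈ Finset.range n, x ^ i) ≤ 1 :=
  V.map_sum_le fun i _ => by rw [map_pow]; exact pow_le_one₀ zero_le hx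

theorem Valuation.map_one_sub_pow_le {R : Type*} [CommRing R] (V : Valuation R Γ) {x : R}
    (hx : V x ≤ 1) (n : ℕ) : V (1 - x ^ n) ≤ V (1 - x) := by
  rw [← mul_neg_geom_sum, map_mul]
  exact mul_le_of_le_one_right' (V.map_geom_sum_le_one hx n)

/-- A nontrivial root of unity of odd order is not congruent to `1` modulo `2`. -/
theorem Valuation.map_one_sub_of_odd {K : Type*} [Field K] (V : Valuation K Γ) (h2 : V 2 < 1)
    {x : K} {m : ℕ} (hm : Odd m) (hx : x ^ m = 1) (hx1 : x ≠ 1) : 1 ≤ V (1 - x) := by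
  by_contra! hlt
  have hVx : V x = 1 := V.map_eq_one_of_pow_eq_one hm.pos.ne' hx
  have hsum : ∑ i ∈ Finset.range m, x ^ i = 0 := by
    have := mul_neg_geom_sum x m
    rw [hx, sub_self, mul_eq_zero, sub_eq_zero] at this
    exact this.resolve_left hx1.symm
  -- If x ≡ 1, every summand is small; but the powers of x sum to 0, so this sum is the odd number
  -- m, a unit.
  have hle : V (∑ i ∈ Finset.range m, (1 - x ^ i)) < 1 :=
    V.map_sum_lt one_ne_zero fun i _ => (V.map_one_sub_pow_le hVx.le i).trans_lt hlt
  rw [Finset.sum_sub_distrib, hsum] at hle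
  simp [V.map_odd_natCast h2 hm] at hle

/-- A root of unity different from `±1` is not congruent to `1` modulo `2`, in the strong sense
that `1 - x` has larger absolute value than `2`. -/
theorem Valuation.map_two_lt_map_one_sub {K : Type*} [Field K] (V : Valuation K Γ) (h2 : V 2 < 1)
    (h20 : (2 : K) ≠ 0)
    {x : K} {n : ℕ} (hn : n ≠ 0) (hx : x ^ n = 1) (hx1 : x ^ 2 ≠ 1) : V 2 < V (1 - x) := by
  have hVx : V x ≤ 1 := (V.map_eq_one_of_pow_eq_one hn hx).le
  have hfin : 0 < orderOf (x ^ 2) :=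
    orderOf_pos_iff.2 (isOfFinOrder_iff_pow_eq_one.2
      ⟨n, hn.bot_lt, by rw [pow_right_comm, hx, one_pow]⟩)
  have hN := pow_orderOf_eq_one (x ^ 2)
  -- For even order 2k, `x ^ k` is a square root of -1, so `V (1 - x ^ k)` is the square root of `V
  -- 2`, which exceeds `V 2`. For odd order, `1 - x ^ 2` already has value at least 1. In both cases
  -- 1 - x divides the element considered.
  rcases Nat.even_or_odd (orderOf (x ^ 2)) with he | ho
  · obtain ⟨k, hk⟩ := he
    have h0 : (x ^ 2) ^ k ≠ 1 := pow_ne_one_of_lt_orderOf (by omega) (by omega)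
    have hneg : (x ^ k) ^ 2 = -1 := by
      rw [hk, ← two_mul, mul_comm, pow_mul, sq_eq_one_iff] at hN
      rw [pow_right_comm]
      exact hN.resolve_left h0
    have hi : V (1 - x ^ k) ^ 2 = V 2 := by
      have : (1 - x ^ k) ^ 2 = -(2 * x ^ k) := by linear_combination hneg
      rw [← map_pow, this, Valuation.map_neg, map_mul,
        V.map_eq_one_of_pow_eq_one (n := 4) (by norm_num) (x := x ^ k)
          (by linear_combination ((x ^ k) ^ 2 - 1) * hneg), mul_one]
    refine lt_of_lt_of_le ?_ (V.map_one_sub_pow_le hVx k)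
    rw [← hi]
    have hpos : 0 < V (1 - x ^ k) := by
      rw [zero_lt_iff]
      intro h
      rw [h] at hi
      rw [zero_pow two_ne_zero, eq_comm, Valuation.zero_iff] at hi
      exact h20 hi
    refine pow_lt_self_of_lt_one₀ hpos ?_ (by norm_num)
    by_contra! h
    exact absurd (one_le_pow₀ (n := 2) h) (by rw [hi]; exact not_le.2 h2)
  · exact h2.trans_le ((V.map_one_sub_of_odd h2 ho hN hx1).trans (V.map_one_sub_pow_le hVx 2))

open Complex in
/-- The `2`-adic size of the entries of a rotation of finite order greater than `2`. -/
theorem cos_eq_zero_or_one_lt (V : Valuation ℂ Γ) (h2 : V 2 < 1) {θ : ℝ} {n : ℕ} (hn : n ≠ 0)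
    (h : exp (θ * I) ^ n = 1) (h1 : exp (θ * I) ^ 2 ≠ 1) :
    exp (θ * I) ^ 2 = -1 ∨
      1 < V (Real.cos θ : ℝ) ∧ V ((Real.sin θ : ℝ) - (Real.cos θ : ℝ)) < V (Real.cos θ : ℝ) := by
  rw [or_iff_not_imp_left]
  intro h3
  set ζ := exp (θ * I) with hζ
  have hζ' : ζ = (Real.cos θ : ℝ) + (Real.sin θ : ℝ) * I := by
    rw [hζ, exp_mul_I]; simp
  have hcs : ((Real.cos θ : ℝ) : ℂ) ^ 2 + (Real.sin θ : ℝ) ^ 2 = 1 := by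
    exact_mod_cast Real.cos_sq_add_sin_sq θ
  generalize ((Real.cos θ : ℝ) : ℂ) = c at *
  generalize ((Real.sin θ : ℝ) : ℂ) = s at *
  have hVζ : V ζ = 1 := V.map_eq_one_of_pow_eq_one hn h
  have hI : V I = 1 := V.map_eq_one_of_pow_eq_one (n := 4) (by norm_num) (by simp)
  have hI2 : V (1 + I) < 1 := by
    have : V (1 + I) ^ 2 < 1 := by
      rw [← map_pow, show (1 + I) ^ 2 = 2 * I by linear_combination I_sq,
        map_mul, hI, mul_one]
      exact h2
    exact (pow_lt_one_iff (by norm_num)).1 this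
  -- This is 2 cos θ = ζ + ζ⁻¹ multiplied by ζ. The root of unity -ζ² is not ±1, so the previous
  -- bound applies to it, and cancelling `V 2` leaves `1 < V c`.
  have hc : 2 * c * ζ = 1 - -(ζ ^ 2) := by
    rw [hζ']
    linear_combination hcs - s ^ 2 * I_sq
  have key := V.map_two_lt_map_one_sub h2 two_ne_zero (x := -(ζ ^ 2)) (n := 2 * n) (by omega)
    (by rw [pow_mul, neg_sq, pow_right_comm, pow_right_comm ζ 2 n, h, one_pow, one_pow])
    (by
      rw [neg_sq, Ne, sq_eq_one_iff]
      exact fun h => h.elim h1 h3)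
  rw [← hc, map_mul, map_mul, hVζ, mul_one] at key
  have hc1 : 1 < V c := by
    by_contra! hle
    exact absurd key (not_lt.2 (mul_le_of_le_one_right' hle))
  refine ⟨hc1, ?_⟩
  -- Both terms in the bracket are smaller than c: ζ is a unit, and 1 + i is small because its
  -- square is 2i.
  have e : s - c = -I * (ζ - c * (1 + I)) := by rw [hζ']; linear_combination (s - c) * I_sq
  rw [e, map_mul, Valuation.map_neg, hI, one_mul]
  refine V.map_sub_lt (by rwa [hVζ]) ?_
  rw [map_mul]
  exact mul_lt_of_lt_one_right (zero_lt_one.trans hc1) hI2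

end Valuation

/-! ### Ping-pong with leading terms modulo 2. -/

section Words

variable {Γ : Type*} [LinearOrderedCommGroupWithZero Γ]

open Matrix

/-- The vector `u` is congruent to `a • y` modulo elements smaller than `a`. -/
def NearVec (v : Valuation ℝ Γ) (u : Fin 3 → ℝ) (a : ℝ) (y : Fin 3 → ℝ) : Prop :=
  ∀ i, v (u i - a * y i) < v a

/-- The matrix `M` is congruent to `c • N` modulo elements smaller than `c`. -/
def NearMat (v : Valuation ℝ Γ) (M : Matrix (Fin 3) (Fin 3) ℝ) (c : ℝ)
    (N : Matrix (Fin 3) (Fin 3) ℝ) : Prop :=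
  ∀ i j, v (M i j - c * N i j) < v c

/-- Leading terms multiply because N and y are integral: every error term is then smaller than c *
a. -/
theorem NearVec.mulVec {v : Valuation ℝ Γ} {M N : Matrix (Fin 3) (Fin 3) ℝ} {u y : Fin 3 → ℝ}
    {a c : ℝ} (hM : NearMat v M c N) (hu : NearVec v u a y) (hN : ∀ i j, v (N i j) ≤ 1)
    (hy : ∀ i, v (y i) ≤ 1) : NearVec v (M *ᵥ u) (c * a) (N *ᵥ y) := by
  intro i
  have e : (M *ᵥ u) i - c * a * (N *ᵥ y) i =
      ∑ j, ((M i j - c * N i j) * u j + c * N i j * (u j - a * y j)) := by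
    simp only [Matrix.mulVec, dotProduct, Finset.mul_sum, ← Finset.sum_sub_distrib]
    exact Finset.sum_congr rfl fun j _ => by ring
  have hc : 0 < v c := zero_le.trans_lt (hM 0 0)
  have ha : 0 < v a := zero_le.trans_lt (hu 0)
  have hua : ∀ j, v (u j) ≤ v a := fun j => by
    rw [show u j = (u j - a * y j) + a * y j by ring]
    refine v.map_add_le (hu j).le ?_
    rw [map_mul]
    exact mul_le_of_le_one_right' (hy j)
  rw [e, map_mul]
  refine v.map_sum_lt (mul_pos hc ha).ne' fun j _ => v.map_add_lt ?_ ?_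
  · rw [map_mul]
    exact (mul_le_mul_right (hua j) _).trans_lt (mul_lt_mul_of_pos_right (hM i j) ha)
  · rw [map_mul, map_mul]
    exact (mul_le_mul_left (mul_le_of_le_one_right' (hN i j)) _).trans_lt
      (mul_lt_mul_of_pos_left (hu j) hc)

theorem NearMat.mul {v : Valuation ℝ Γ} {M N M' N' : Matrix (Fin 3) (Fin 3) ℝ}
    {a c : ℝ} (hM : NearMat v M c N) (hM' : NearMat v M' a N') (hN : ∀ i j, v (N i j) ≤ 1)
    (hN' : ∀ i j, v (N' i j) ≤ 1) : NearMat v (M * M') (c * a) (N * N') := by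
  intro i j
  exact NearVec.mulVec (u := fun k => M' k j) (y := fun k => N' k j) hM (fun k => hM' k j) hN
    (fun k => hN' k j) i

/-- The reduction modulo `2` of a rescaled rotation about the `x`-axis. -/
def residueX : Matrix (Fin 3) (Fin 3) ℝ := !![0, 0, 0; 0, 1, 1; 0, 1, 1]

/-- The reduction modulo `2` of a quarter turn about the `x`-axis. -/
def residueQuarter : Matrix (Fin 3) (Fin 3) ℝ := !![1, 0, 0; 0, 0, 1; 0, 1, 0]

/-- The reduction modulo `2` of a rescaled rotation about the `z`-axis. -/
def residueZ : Matrix (Fin 3) (Fin 3) ℝ := !![1, 1, 0; 1, 1, 0; 0, 0, 0]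

/-- The letters of alternating words: matrices which reduce modulo `2` like rotations about
the `x`-axis (for `false`) or the `z`-axis (for `true`) that are not half turns. -/
def IsLetter (v : Valuation ℝ Γ) : Bool → Matrix (Fin 3) (Fin 3) ℝ → Prop
  | false, M => (∃ c, 1 < v c ∧ NearMat v M c residueX) ∨ NearMat v M 1 residueQuarter
  | true, M => ∃ c, 1 < v c ∧ NearMat v M c residueZ

/-- Lets a half turn, the image of a dihedral reflection, be absorbed into the letter that follows
it. -/
theorem NearMat.isLetter_mul {v : Valuation ℝ Γ} {D M : Matrix (Fin 3) (Fin 3) ℝ} {b : Bool}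
    (hD : NearMat v D 1 1) (hM : IsLetter v b M) : IsLetter v b (D * M) := by
  have h1 : ∀ i j, v ((1 : Matrix (Fin 3) (Fin 3) ℝ) i j) ≤ 1 := by
    intro i j; fin_cases i <;> fin_cases j <;> simp
  have key : ∀ {c N}, NearMat v M c N → (∀ i j, v (N i j) ≤ 1) → NearMat v (D * M) c N := by
    intro c N h hN
    simpa using hD.mul h h1 hN
  cases b with
  | false =>
    refine hM.imp (fun ⟨c, hc, h⟩ => ⟨c, hc, key h ?_⟩) fun h => key h ?_ <;>
    · intro i j; fin_cases i <;> fin_cases j <;> simp [residueX, residueQuarter]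
  | true =>
    obtain ⟨c, hc, h⟩ := hM
    refine ⟨c, hc, key h ?_⟩
    intro i j; fin_cases i <;> fin_cases j <;> simp [residueZ]

/-- Half of the ping-pong table. A generic letter enlarges the vector; a quarter turn only exchanges
its last two coordinates, leaving the scale a unchanged. -/
theorem IsLetter.mulVec_false {v : Valuation ℝ Γ} {M : Matrix (Fin 3) (Fin 3) ℝ}
    {u : Fin 3 → ℝ} {a : ℝ} (hM : IsLetter v false M) (hu : NearVec v u a ![1, 1, 0]) :
    (∃ c, 1 < v c ∧ NearVec v (M *ᵥ u) (c * a) ![0, 1, 1]) ∨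
      NearVec v (M *ᵥ u) a ![1, 0, 1] := by
  have hy : ∀ i, v ((![1, 1, 0] : Fin 3 → ℝ) i) ≤ 1 := by intro i; fin_cases i <;> simp
  rcases hM with ⟨c, hc, h⟩ | h
  · refine .inl ⟨c, hc, ?_⟩
    have := NearVec.mulVec h hu
      (by intro i j; fin_cases i <;> fin_cases j <;> simp [residueX]) hy
    rwa [show residueX *ᵥ ![1, 1, 0] = ![0, 1, 1] by
      ext i; fin_cases i <;> simp [residueX]] at this
  · refine .inr ?_
    have := NearVec.mulVec h hu
      (by intro i j; fin_cases i <;> fin_cases j <;> simp [residueQuarter]) hy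
    rwa [one_mul, show residueQuarter *ᵥ ![1, 1, 0] = ![1, 0, 1] by
      ext i; fin_cases i <;> simp [residueQuarter]] at this

/-- Both possible directions have first two coordinates summing to 1, so `residueZ` does not kill
them, and every letter about z causes growth. -/
theorem IsLetter.mulVec_true {v : Valuation ℝ Γ} {M : Matrix (Fin 3) (Fin 3) ℝ}
    {u y : Fin 3 → ℝ} {a : ℝ} (hM : IsLetter v true M) (hy : y = ![0, 1, 1] ∨ y = ![1, 0, 1])
    (hu : NearVec v u a y) :
    ∃ c, 1 < v c ∧ NearVec v (M *ᵥ u) (c * a) ![1, 1, 0] := by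
  obtain ⟨c, hc, h⟩ := hM
  refine ⟨c, hc, ?_⟩
  have := NearVec.mulVec h hu
    (by intro i j; fin_cases i <;> fin_cases j <;> simp [residueZ])
    (by rcases hy with rfl | rfl <;> intro i <;> fin_cases i <;> simp)
  rwa [show residueZ *ᵥ y = ![1, 1, 0] by
    rcases hy with rfl | rfl <;> ext i <;> fin_cases i <;> simp [residueZ]] at this

/-- The directions of the images under words that start with a given kind of letter. -/
def IsDirection : Bool → (Fin 3 → ℝ) → Prop
  | false, y => y = ![0, 1, 1] ∨ y = ![1, 0, 1]
  | true, y => y = ![1, 1, 0]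

/-- The property of being moved far from the identity, in the way that nonempty alternating
words are. -/
def IsMoved (v : Valuation ℝ Γ) (b : Bool) (M : Matrix (Fin 3) (Fin 3) ℝ) : Prop :=
  ∃ e a y, (e = ![1, 1, 0] ∨ e = ![0, 1, 1]) ∧ IsDirection b y ∧ NearVec v (M *ᵥ e) a y ∧
    (1 < v a ∨ b = false ∧ e = ![1, 1, 0] ∧ a = 1 ∧ y = ![1, 0, 1])

theorem NearVec.self (v : Valuation ℝ Γ) (e : Fin 3 → ℝ) : NearVec v e 1 e := by
  intro i; simp

theorem IsLetter.isMoved {v : Valuation ℝ Γ} {b : Bool} {M : Matrix (Fin 3) (Fin 3) ℝ}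
    (hM : IsLetter v b M) : IsMoved v b M := by
  cases b with
  | false =>
    rcases hM.mulVec_false (NearVec.self v _) with ⟨c, hc, h⟩ | h
    · exact ⟨_, _, _, .inl rfl, .inl rfl, h, .inl (by rwa [mul_one])⟩
    · exact ⟨_, _, _, .inl rfl, .inr rfl, h, .inr ⟨rfl, rfl, rfl, rfl⟩⟩
  | true =>
    obtain ⟨c, hc, h⟩ := hM.mulVec_true (.inl rfl) (NearVec.self v _)
    exact ⟨_, _, _, .inr rfl, rfl, h, .inl (by rwa [mul_one])⟩

/-- Letters about z enlarge and letters about x never shrink, so once there are two letters the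
vector has grown. The exceptional alternative of `IsMoved` is only needed for a single quarter turn.
-/
theorem IsMoved.mul {v : Valuation ℝ Γ} {b b' : Bool} {M N : Matrix (Fin 3) (Fin 3) ℝ}
    (hM : IsLetter v b M) (hN : IsMoved v b' N) (hb : b ≠ b') : IsMoved v b (M * N) := by
  obtain ⟨e, a, y, he, hy, hn, ha⟩ := hN
  cases b with
  | false =>
    obtain rfl : b' = true := by simpa using hb
    obtain rfl : y = _ := hy
    have ha : 1 < v a := by simpa using ha
    rcases hM.mulVec_false hn with ⟨c, hc, h⟩ | h
    · refine ⟨e, c * a, _, he, .inl rfl, by rwa [← mulVec_mulVec], .inl ?_⟩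
      rw [map_mul]
      exact one_lt_mul_of_lt_of_le hc ha.le
    · exact ⟨e, a, _, he, .inr rfl, by rwa [← mulVec_mulVec], .inl ha⟩
  | true =>
    obtain rfl : b' = false := by simpa using hb
    have ha : 1 ≤ v a := by
      rcases ha with ha | ⟨-, -, rfl, -⟩
      · exact ha.le
      · simp
    obtain ⟨c, hc, h⟩ := hM.mulVec_true hy hn
    refine ⟨e, c * a, _, he, rfl, by rwa [← mulVec_mulVec], .inl ?_⟩
    rw [map_mul]
    exact one_lt_mul_of_lt_of_le hc ha

/-- A matrix congruent to 1 keeps integral vectors integral, which excludes growth. In the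
exceptional case the middle coordinate would be congruent to both 1 and 0. -/
theorem IsMoved.not_nearMat_one {v : Valuation ℝ Γ} {b : Bool} {M : Matrix (Fin 3) (Fin 3) ℝ}
    (hM : IsMoved v b M) : ¬ NearMat v M 1 1 := by
  intro hD
  obtain ⟨e, a, y, he, hy, hn, ha⟩ := hM
  have he1 : ∀ i, v (e i) ≤ 1 := by
    rcases he with rfl | rfl <;> intro i <;> fin_cases i <;> simp
  have hMe : NearVec v (M *ᵥ e) 1 e := by
    simpa using NearVec.mulVec hD (NearVec.self v e)
      (by intro i j; fin_cases i <;> fin_cases j <;> simp) he1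
  rcases ha with ha | ⟨-, rfl, rfl, rfl⟩
  · obtain ⟨i, hi⟩ : ∃ i, y i = 1 := by
      cases b with
      | false => rcases hy with rfl | rfl <;> exact ⟨2, rfl⟩
      | true => obtain rfl : y = _ := hy; exact ⟨0, rfl⟩
    have h1 : v ((M *ᵥ e) i) ≤ 1 := by
      have := v.map_add_le (x := (M *ᵥ e) i - 1 * e i) (y := e i) (g := 1)
        (by simpa using (hMe i).le) (he1 i)
      simpa using this
    have h2 := v.map_sub_lt (h1.trans_lt ha) (hn i)
    rw [hi] at h2
    simp at h2
  · have h := v.map_sub_lt (hMe 1) (hn 1)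
    simp at h

/-- Nonempty alternating words are not congruent to the identity modulo `2`. -/
theorem not_nearMat_prod {v : Valuation ℝ Γ} {l : List (Bool × Matrix (Fin 3) (Fin 3) ℝ)}
    (hl : l ≠ []) (hchain : l.IsChain fun x y => x.1 ≠ y.1)
    (hletter : ∀ x ∈ l, IsLetter v x.1 x.2) : ¬ NearMat v (l.map Prod.snd).prod 1 1 := by
  suffices ∀ (l : List (Bool × Matrix (Fin 3) (Fin 3) ℝ)) x,
      (x :: l).IsChain (fun x y => x.1 ≠ y.1) → (∀ y ∈ x :: l, IsLetter v y.1 y.2) →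
      IsMoved v x.1 ((x :: l).map Prod.snd).prod by
    cases l with
    | nil => exact absurd rfl hl
    | cons x l => exact (this l x hchain hletter).not_nearMat_one
  clear hletter hchain hl l
  intro l
  induction l with
  | nil =>
    intro x _ h
    simpa using (h x (by simp)).isMoved
  | cons y l ih =>
    intro x hc h
    rw [List.isChain_cons_cons] at hc
    rw [List.map_cons, List.prod_cons]
    exact IsMoved.mul (h x (by simp)) (ih y hc.2 fun z hz => h z (List.mem_cons_of_mem _ hz)) hc.1

end Words

/-! ### Rotations of finite order as letters. -/

section Rotations

theorem rotX_add (a b : ℝ) : rotX (a + b) = rotX a * rotX b := by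
  apply Subtype.ext
  rw [Submonoid.coe_mul]
  ext i j
  fin_cases i <;> fin_cases j <;>
    simp [rotX, Matrix.mul_apply, Fin.sum_univ_three, Real.cos_add, Real.sin_add] <;> ring

theorem rotZ_add (a b : ℝ) : rotZ (a + b) = rotZ a * rotZ b := by
  apply Subtype.ext
  rw [Submonoid.coe_mul]
  ext i j
  fin_cases i <;> fin_cases j <;>
    simp [rotZ, Matrix.mul_apply, Fin.sum_univ_three, Real.cos_add, Real.sin_add] <;> ring

theorem exp_mul_I_eq_one_iff (θ : ℝ) :
    Complex.exp (θ * Complex.I) = 1 ↔ Real.cos θ = 1 ∧ Real.sin θ = 0 := by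
  simp [Complex.ext_iff]

theorem rotX_eq_one_iff (θ : ℝ) : rotX θ = 1 ↔ Complex.exp (θ * Complex.I) = 1 := by
  rw [exp_mul_I_eq_one_iff, Subtype.ext_iff, ← Matrix.ext_iff]
  simp [rotX, Fin.forall_fin_succ]
  tauto

theorem rotZ_eq_one_iff (θ : ℝ) : rotZ θ = 1 ↔ Complex.exp (θ * Complex.I) = 1 := by
  rw [exp_mul_I_eq_one_iff, Subtype.ext_iff, ← Matrix.ext_iff]
  simp [rotZ, Fin.forall_fin_succ]
  tauto

/-- Rotations about the `x`-axis, as a homomorphism. -/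
noncomputable def rotXHom : Multiplicative ℝ →* SO3 :=
  MonoidHom.mk' (fun θ => rotX θ.toAdd) fun _ _ => rotX_add _ _

/-- Rotations about the `z`-axis, as a homomorphism. -/
noncomputable def rotZHom : Multiplicative ℝ →* SO3 :=
  MonoidHom.mk' (fun θ => rotZ θ.toAdd) fun _ _ => rotZ_add _ _

theorem rotX_zpow (θ : ℝ) (n : ℤ) : rotX θ ^ n = rotX (n * θ) := by
  have := map_zpow rotXHom (Multiplicative.ofAdd θ) n
  rw [← ofAdd_zsmul, zsmul_eq_mul] at this
  exact this.symm

theorem rotZ_zpow (θ : ℝ) (n : ℤ) : rotZ θ ^ n = rotZ (n * θ) := by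
  have := map_zpow rotZHom (Multiplicative.ofAdd θ) n
  rw [← ofAdd_zsmul, zsmul_eq_mul] at this
  exact this.symm

theorem rotX_pow (θ : ℝ) (n : ℕ) : rotX θ ^ n = rotX (n * θ) := mod_cast rotX_zpow θ n

theorem rotZ_pow (θ : ℝ) (n : ℕ) : rotZ θ ^ n = rotZ (n * θ) := mod_cast rotZ_zpow θ n

theorem rotX_pow_eq_one_iff (θ : ℝ) (n : ℕ) :
    rotX θ ^ n = 1 ↔ Complex.exp (θ * Complex.I) ^ n = 1 := by
  rw [rotX_pow, rotX_eq_one_iff, ← Complex.exp_nat_mul]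
  push_cast
  rw [mul_assoc]

theorem rotZ_pow_eq_one_iff (θ : ℝ) (n : ℕ) :
    rotZ θ ^ n = 1 ↔ Complex.exp (θ * Complex.I) ^ n = 1 := by
  rw [rotZ_pow, rotZ_eq_one_iff, ← Complex.exp_nat_mul]
  push_cast
  rw [mul_assoc]

theorem isPrimitiveRoot_exp_angle {p : ℕ} (hp : p ≠ 0) :
    IsPrimitiveRoot (Complex.exp ((2 * Real.pi / p : ℝ) * Complex.I)) p := by
  convert Complex.isPrimitiveRoot_exp p hp using 2
  push_cast
  ring

theorem rotX_angle_pow_eq_one_iff {p : ℕ} (hp : p ≠ 0) (n : ℕ) :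
    rotX (2 * Real.pi / p) ^ n = 1 ↔ p ∣ n := by
  rw [rotX_pow_eq_one_iff, (isPrimitiveRoot_exp_angle hp).pow_eq_one_iff_dvd]

theorem rotZ_angle_pow_eq_one_iff {p : ℕ} (hp : p ≠ 0) (n : ℕ) :
    rotZ (2 * Real.pi / p) ^ n = 1 ↔ p ∣ n := by
  rw [rotZ_pow_eq_one_iff, (isPrimitiveRoot_exp_angle hp).pow_eq_one_iff_dvd]

theorem half_mul_angle {p : ℕ} (hp : p ≠ 0) (h : Even p) :
    ((p / 2 : ℕ) : ℝ) * (2 * Real.pi / p) = Real.pi := by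
  rw [Nat.cast_div h.two_dvd two_ne_zero]
  field_simp
  push_cast
  ring

theorem rotX_angle_pow_half {p : ℕ} (hp : p ≠ 0) (h : Even p) :
    rotX (2 * Real.pi / p) ^ (p / 2) = rotX Real.pi := by
  rw [rotX_pow, half_mul_angle hp h]

theorem rotZ_angle_pow_half {p : ℕ} (hp : p ≠ 0) (h : Even p) :
    rotZ (2 * Real.pi / p) ^ (p / 2) = rotZ Real.pi := by
  rw [rotZ_pow, half_mul_angle hp h]

theorem rotX_pi_mul_rotZ_sq (θ : ℝ) : (rotX Real.pi * rotZ θ) ^ 2 = 1 := by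
  apply Subtype.ext
  rw [sq, Submonoid.coe_mul, Submonoid.coe_mul]
  have h := Real.sin_sq_add_cos_sq θ
  ext i j
  fin_cases i <;> fin_cases j <;>
    simp [rotX, rotZ, Matrix.mul_apply, Fin.sum_univ_three] <;> linarith

theorem rotX_mul_rotZ_pi_sq (θ : ℝ) : (rotX θ * rotZ Real.pi) ^ 2 = 1 := by
  apply Subtype.ext
  rw [sq, Submonoid.coe_mul, Submonoid.coe_mul]
  have h := Real.sin_sq_add_cos_sq θ
  ext i j
  fin_cases i <;> fin_cases j <;>
    simp [rotX, rotZ, Matrix.mul_apply, Fin.sum_univ_three] <;> linarith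

theorem rotX_pi_ne_one : rotX Real.pi ≠ 1 := by
  rw [Ne, rotX_eq_one_iff, exp_mul_I_eq_one_iff]
  norm_num

theorem rotZ_pi_ne_one : rotZ Real.pi ≠ 1 := by
  rw [Ne, rotZ_eq_one_iff, exp_mul_I_eq_one_iff]
  norm_num

theorem rotZ_pi_mul_rotX_pi_ne_one : rotZ Real.pi * rotX Real.pi ≠ 1 := by
  intro h
  have := congrArg (fun M : SO3 => (M : Matrix (Fin 3) (Fin 3) ℝ) 0 0) h
  simp [rotX, rotZ] at this
  norm_num at this

variable {Γ : Type*} [LinearOrderedCommGroupWithZero Γ]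

theorem nearMat_one_one (v : Valuation ℝ Γ) : NearMat v (1 : SO3) 1 1 := by
  intro i j; simp

theorem NearMat.mul_one_one {v : Valuation ℝ Γ} {M N : SO3} (hM : NearMat v M 1 1)
    (hN : NearMat v N 1 1) : NearMat v (M * N : SO3) 1 1 := by
  have h1 : ∀ i j, v ((1 : Matrix (Fin 3) (Fin 3) ℝ) i j) ≤ 1 := by
    intro i j; fin_cases i <;> fin_cases j <;> simp
  simpa using NearMat.mul hM hN h1 h1

theorem nearMat_rotX_pi {v : Valuation ℝ Γ} (h2 : v 2 < 1) : NearMat v (rotX Real.pi) 1 1 := by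
  have h : v (-1 - 1) < 1 := by rwa [← Valuation.map_neg, show -(-1 - 1 : ℝ) = 2 by norm_num]
  intro i j
  fin_cases i <;> fin_cases j <;> simp [rotX, h]

theorem nearMat_rotZ_pi {v : Valuation ℝ Γ} (h2 : v 2 < 1) : NearMat v (rotZ Real.pi) 1 1 := by
  have h : v (-1 - 1) < 1 := by rwa [← Valuation.map_neg, show -(-1 - 1 : ℝ) = 2 by norm_num]
  intro i j
  fin_cases i <;> fin_cases j <;> simp [rotZ, h]

/-- Signs do not matter modulo 2; this handles the entry -sin θ of a rotation matrix. -/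
theorem Valuation.map_neg_sub_lt {v : Valuation ℝ Γ} (h2 : v 2 < 1) {c s : ℝ}
    (h : v (s - c) < v c) : v (-s - c) < v c := by
  have hc : 0 < v c := zero_le.trans_lt h
  rw [show -s - c = -(s - c) - 2 * c by ring]
  refine v.map_sub_lt (by rwa [Valuation.map_neg]) ?_
  rw [map_mul]
  exact mul_lt_of_lt_one_left hc h2

theorem isLetter_rotX {V : Valuation ℂ Γ} (h2 : V 2 < 1) {θ : ℝ} {n : ℕ} (hn : n ≠ 0)
    (h : rotX θ ^ n = 1) (h1 : rotX θ ^ 2 ≠ 1) :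
    IsLetter (V.comap Complex.ofRealHom) false (rotX θ) := by
  rw [rotX_pow_eq_one_iff] at h
  rw [Ne, rotX_pow_eq_one_iff] at h1
  set v : Valuation ℝ Γ := V.comap Complex.ofRealHom
  have hv2 : v 2 < 1 := by simpa [v] using h2
  rcases cos_eq_zero_or_one_lt V h2 hn h h1 with h0 | ⟨hc, hs⟩
  · right
    have hcos : Real.cos θ = 0 ∧ (Real.sin θ = 1 ∨ Real.sin θ = -1) := by
      have hcs := Real.cos_sq_add_sin_sq θ
      have := congrArg Complex.re h0
      rw [Complex.exp_mul_I, sq, Complex.mul_re] at this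
      simp [← Complex.ofReal_cos, ← Complex.ofReal_sin] at this
      have h3 : Real.cos θ ^ 2 = 0 := by nlinarith
      refine ⟨by simpa using h3, ?_⟩
      rw [h3, zero_add] at hcs
      exact sq_eq_one_iff.1 hcs
    have hm : v (-1 - 1) < 1 := by
      rwa [← Valuation.map_neg, show -(-1 - 1 : ℝ) = 2 by norm_num]
    obtain ⟨hc, hs | hs⟩ := hcos <;> intro i j <;> fin_cases i <;> fin_cases j <;>
      simp [rotX, residueQuarter, hc, hs, hm]
  · left
    have hc : 1 < v (Real.cos θ) := hc
    have hs : v (Real.sin θ - Real.cos θ) < v (Real.cos θ) := by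
      simpa [v] using hs
    have h0 : 0 < v (Real.cos θ) := zero_lt_one.trans hc
    refine ⟨_, hc, ?_⟩
    have hs' := Valuation.map_neg_sub_lt hv2 hs
    intro i j
    fin_cases i <;> fin_cases j <;> simp only [rotX, residueX] <;>
      first | simpa using h0 | simpa using hc | simpa using hs | simpa using hs'

/-- The exponent 2m with m odd rules out quarter turns: ζ² = -1 would give ζ^(2m) = -1. -/
theorem isLetter_rotZ {V : Valuation ℂ Γ} (h2 : V 2 < 1) {θ : ℝ} {m : ℕ} (hm : Odd m)
    (h : rotZ θ ^ (2 * m) = 1) (h1 : rotZ θ ^ 2 ≠ 1) :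
    IsLetter (V.comap Complex.ofRealHom) true (rotZ θ) := by
  rw [rotZ_pow_eq_one_iff] at h
  rw [Ne, rotZ_pow_eq_one_iff] at h1
  set v : Valuation ℝ Γ := V.comap Complex.ofRealHom
  have hv2 : v 2 < 1 := by simpa [v] using h2
  have hm0 := hm.pos
  rcases cos_eq_zero_or_one_lt V h2 (by omega) h h1 with h0 | ⟨hc, hs⟩
  · rw [pow_mul, h0, hm.neg_one_pow] at h
    norm_num at h
  · have hc : 1 < v (Real.cos θ) := hc
    have hs : v (Real.sin θ - Real.cos θ) < v (Real.cos θ) := by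
      simpa [v] using hs
    have h0 : 0 < v (Real.cos θ) := zero_lt_one.trans hc
    refine ⟨_, hc, ?_⟩
    have hs' := Valuation.map_neg_sub_lt hv2 hs
    intro i j
    fin_cases i <;> fin_cases j <;> simp only [rotZ, residueZ] <;>
      first | simpa using h0 | simpa using hc | simpa using hs | simpa using hs'

end Rotations

/-! ### Homomorphisms out of cyclic and dihedral groups. -/

section Lifts

variable {G : Type*} [Group G]

/-- The homomorphism from `ℤ_n` given by an element whose `n`-th power is trivial. -/
def cycLift {n : ℕ} (a : G) (ha : a ^ n = 1) : Cyc n →* G :=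
  AddMonoidHom.toMultiplicativeLeft
    (ZMod.lift n ⟨zmultiplesHom (Additive G) (Additive.ofMul a), by
      simpa [← ofMul_pow] using ha⟩)

theorem cycLift_intCast {n : ℕ} (a : G) (ha : a ^ n = 1) (k : ℤ) :
    cycLift a ha (Multiplicative.ofAdd (k : ZMod n)) = a ^ k := by
  simp [cycLift]

@[simp]
theorem cycLift_cycGen {n : ℕ} (a : G) (ha : a ^ n = 1) : cycLift a ha (cycGen n) = a := by
  have := cycLift_intCast a ha 1
  rw [Int.cast_one, zpow_one] at this
  exact this

theorem cyc_eq_pow {n : ℕ} (hn : n ≠ 0) (x : Cyc n) : ∃ k : ℕ, x = cycGen n ^ k := by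
  have : NeZero n := ⟨hn⟩
  refine ⟨(Multiplicative.toAdd x).val, ?_⟩
  apply Multiplicative.toAdd.injective
  simp [cycGen]

theorem cycGen_pow_eq_one_iff {n k : ℕ} : cycGen n ^ k = 1 ↔ n ∣ k := by
  rw [← ZMod.natCast_eq_zero_iff, ← Multiplicative.toAdd.injective.eq_iff]
  simp [cycGen]

theorem cycGen_pow_self (n : ℕ) : cycGen n ^ n = 1 := cycGen_pow_eq_one_iff.2 dvd_rfl

theorem Cyc.hom_ext {n : ℕ} {f g : Cyc n →* G} (h : f (cycGen n) = g (cycGen n)) : f = g := by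
  refine MonoidHom.ext fun x => ?_
  obtain ⟨k, hk⟩ := ZMod.intCast_surjective (Multiplicative.toAdd x)
  obtain rfl : x = cycGen n ^ k := by
    apply Multiplicative.toAdd.injective
    rw [← hk, cycGen, ← ofAdd_zsmul]
    simp
  rw [map_zpow, map_zpow, h]

theorem zpow_mul_eq_mul_zpow_neg {a b : G} (hb : b ^ 2 = 1) (hab : (a * b) ^ 2 = 1) (k : ℤ) :
    a ^ k * b = b * a ^ (-k) := by
  have hb' : b⁻¹ = b := by rw [inv_eq_iff_mul_eq_one, ← sq, hb]
  have h : SemiconjBy b a⁻¹ a := by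
    rw [SemiconjBy, ← mul_inv_eq_iff_eq_mul.symm, eq_comm]
    rw [sq, ← eq_inv_iff_mul_eq_one, mul_inv_rev, hb'] at hab
    rw [hab, inv_mul_cancel_right]
  have := h.zpow_right k
  rw [inv_zpow', SemiconjBy] at this
  exact this.symm

/-- The homomorphism from the dihedral group given by a rotation and a reflection. -/
def dihedralLift {n : ℕ} (a b : G) (ha : a ^ n = 1) (hb : b ^ 2 = 1) (hab : (a * b) ^ 2 = 1) :
    DihedralGroup n →* G :=
  MonoidHom.mk'
    (fun
      | .r i => cycLift a ha (Multiplicative.ofAdd i)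
      | .sr i => b * cycLift a ha (Multiplicative.ofAdd i))
    (by
      have hb2 : b * b = 1 := by rw [← sq, hb]
      rintro (i | i) (j | j) <;>
      · obtain ⟨i, rfl⟩ := ZMod.intCast_surjective i
        obtain ⟨j, rfl⟩ := ZMod.intCast_surjective j
        simp only [DihedralGroup.r_mul_r, DihedralGroup.r_mul_sr, DihedralGroup.sr_mul_r,
          DihedralGroup.sr_mul_sr, ← Int.cast_add, ← Int.cast_sub, cycLift_intCast]
        first
        | exact zpow_add a i j
        | rw [zpow_add, mul_assoc]
        | rw [← mul_assoc, zpow_mul_eq_mul_zpow_neg hb hab, mul_assoc, ← zpow_add,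
            neg_add_eq_sub]
        | rw [mul_assoc, ← mul_assoc _ b, zpow_mul_eq_mul_zpow_neg hb hab, mul_assoc, ← zpow_add,
            neg_add_eq_sub, ← mul_assoc, hb2, one_mul])

section

variable {n : ℕ} (a b : G) (ha : a ^ n = 1) (hb : b ^ 2 = 1) (hab : (a * b) ^ 2 = 1)

@[simp]
theorem dihedralLift_r_one : dihedralLift a b ha hb hab (.r 1) = a := by
  exact cycLift_cycGen a ha

@[simp]
theorem dihedralLift_sr_zero : dihedralLift a b ha hb hab (.sr 0) = b := by
  have : b * cycLift a ha (Multiplicative.ofAdd 0) = b := by simp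
  exact this

end

theorem dihedral_eq_pow {n : ℕ} (hn : n ≠ 0) (x : DihedralGroup n) :
    ∃ k : ℕ, x = .r 1 ^ k ∨ x = .sr 0 * .r 1 ^ k := by
  have : NeZero n := ⟨hn⟩
  rcases x with i | i <;> refine ⟨i.val, ?_⟩ <;> simp

theorem DihedralGroup.hom_ext {n : ℕ} {f g : DihedralGroup n →* G} (hr : f (.r 1) = g (.r 1))
    (hs : f (.sr 0) = g (.sr 0)) : f = g := by
  have key : ∀ k : ℤ, f (.r k) = g (.r k) := fun k => by
    rw [← DihedralGroup.r_one_zpow, map_zpow, map_zpow, hr]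
  ext x
  rcases x with i | i <;> obtain ⟨i, rfl⟩ := ZMod.intCast_surjective i
  · exact key i
  · rw [← zero_add (i : ZMod n), ← DihedralGroup.sr_mul_r, map_mul, map_mul, key, hs]

theorem dihedral_two_eq (x : DihedralGroup 2) :
    x = 1 ∨ x = .r 1 ∨ x = .sr 0 ∨ x = .sr 0 * .r 1 := by
  revert x; decide

theorem cyc_two_eq (x : Cyc 2) : x = 1 ∨ x = cycGen 2 := by
  revert x; unfold cycGen; decide

theorem DihedralGroup.hom_two_injective (f : DihedralGroup 2 →* G) (hr : f (.r 1) ≠ 1)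
    (hs : f (.sr 0) ≠ 1) (hsr : f (.sr 0) * f (.r 1) ≠ 1) : Function.Injective f := by
  rw [injective_iff_map_eq_one]
  intro x hx
  rcases dihedral_two_eq x with rfl | rfl | rfl | rfl
  · rfl
  · exact absurd hx hr
  · exact absurd hx hs
  · rw [map_mul] at hx; exact absurd hx hsr

theorem Cyc.hom_two_injective (f : Cyc 2 →* G) (h : f (cycGen 2) ≠ 1) : Function.Injective f := by
  rw [injective_iff_map_eq_one]
  intro x hx
  rcases cyc_two_eq x with rfl | rfl
  · rfl
  · exact absurd hx h

end Lifts

/-! ### Amalgamated products and injectivity from normal forms. -/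

section Amalgam

variable {H K L G : Type} [Group H] [Group K] [Group L] [Group G] {φ : H →* K} {ψ : H →* L}

theorem Amalgam.inl_apply_eq_inr_apply (h : H) :
    Amalgam.inl φ ψ (φ h) = Amalgam.inr φ ψ (ψ h) :=
  (Monoid.PushoutI.of_apply_eq_base (amalgHom φ ψ) false h).trans
    (Monoid.PushoutI.of_apply_eq_base (amalgHom φ ψ) true h).symm

/-- A pair of homomorphisms into `G`, as a family. -/
def amalgDescFamily (f : K →* G) (g : L →* G) : ∀ i, AmalgFactor K L i →* G
  | false => f
  | true => g

/-- The universal property of the amalgamated product. -/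
def Amalgam.desc (f : K →* G) (g : L →* G) (h : ∀ x, f (φ x) = g (ψ x)) : Amalgam φ ψ →* G :=
  Monoid.PushoutI.lift (amalgDescFamily f g) (f.comp φ) (by
    rintro (_ | _)
    · rfl
    · exact MonoidHom.ext fun x => (h x).symm)

@[simp]
theorem Amalgam.desc_inl (f : K →* G) (g : L →* G) (h : ∀ x, f (φ x) = g (ψ x)) (x : K) :
    Amalgam.desc f g h (Amalgam.inl φ ψ x) = f x :=
  Monoid.PushoutI.lift_of (φ := amalgHom φ ψ) (i := false) (amalgDescFamily f g) (f.comp φ) _ x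

@[simp]
theorem Amalgam.desc_inr (f : K →* G) (g : L →* G) (h : ∀ x, f (φ x) = g (ψ x)) (x : L) :
    Amalgam.desc f g h (Amalgam.inr φ ψ x) = g x :=
  Monoid.PushoutI.lift_of (φ := amalgHom φ ψ) (i := true) (amalgDescFamily f g) (f.comp φ) _ x

/-- A homomorphism from an amalgamated product to `SO(3)` is injective if it is injective on the
amalgamated subgroup, which it sends into the matrices congruent to the identity modulo `2`, and
sends the other elements of the factors to letters of the two kinds. -/
theorem Amalgam.injective_of_isLetter {Γ : Type*} [LinearOrderedCommGroupWithZero Γ]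
    {v : Valuation ℝ Γ} (hφ : Function.Injective φ) (hψ : Function.Injective ψ)
    (F : Amalgam φ ψ →* SO3) (hinj : ∀ h, F (Amalgam.inl φ ψ (φ h)) = 1 → h = 1)
    (hnear : ∀ h, NearMat v (F (Amalgam.inl φ ψ (φ h))) 1 1)
    (hK : ∀ t, t ∉ φ.range → IsLetter v false (F (Amalgam.inl φ ψ t)))
    (hL : ∀ t, t ∉ ψ.range → IsLetter v true (F (Amalgam.inr φ ψ t))) :
    Function.Injective F := by
  classical
  obtain ⟨d⟩ := Monoid.PushoutI.NormalWord.transversal_nonempty (amalgHom φ ψ)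
    (by rintro (_ | _); exacts [hφ, hψ])
  have hbase : ∀ h, Monoid.PushoutI.base (amalgHom φ ψ) h = Amalgam.inl φ ψ (φ h) := fun h =>
    (Monoid.PushoutI.of_apply_eq_base (amalgHom φ ψ) false h).symm
  have hletter : ∀ i (t : AmalgFactor K L i), t ∉ (amalgHom φ ψ i).range →
      IsLetter v i (F (Monoid.PushoutI.of i t)) := by
    rintro (_ | _) t ht
    exacts [hK t ht, hL t ht]
  rw [injective_iff_map_eq_one]
  intro x hx
  obtain ⟨w, rfl⟩ := (Monoid.PushoutI.NormalWord.equiv (d := d)).symm.surjective x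
  change F w.prod = 1 at hx
  change w.prod = 1
  set g : (Σ i, AmalgFactor K L i) → Bool × Matrix (Fin 3) (Fin 3) ℝ :=
    fun l => (l.1, (F (Monoid.PushoutI.of l.1 l.2) : SO3))
  have hprod : ((w.toList.map g).map Prod.snd).prod =
      (F (Monoid.PushoutI.ofCoprodI w.toWord.prod) : SO3) := by
    rw [Monoid.CoprodI.Word.prod]
    generalize w.toList = l
    induction l with
    | nil => simp
    | cons a l ih =>
      simp only [List.map_cons, List.prod_cons, map_mul, Submonoid.coe_mul, ih]
      simp [g]
  -- A letter of a normal word is a nontrivial representative from a transversal containing 1, so it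
  -- lies outside the amalgamated subgroup.
  have hmem : ∀ l ∈ w.toList, l.2 ∉ (amalgHom φ ψ l.1).range := by
    rintro ⟨i, t⟩ hl ht
    have hd := w.normalized i t hl
    refine w.ne_one _ hl ?_
    have := (d.compl i).equiv_snd_eq_self_iff_mem (one_mem _) |>.2 hd
    exact this.symm.trans (((d.compl i).coe_equiv_snd_eq_one_iff_mem (d.one_mem i)).2 ht)
  -- The head lies in the amalgamated subgroup. If F kills the product, the alternating part has the
  -- image of an element of that subgroup, congruent to 1, so it must be empty.
  have hF : F (Monoid.PushoutI.ofCoprodI w.toWord.prod) = F (Amalgam.inl φ ψ (φ w.head⁻¹)) := by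
    rw [Monoid.PushoutI.NormalWord.prod, map_mul, hbase] at hx
    rw [map_inv, map_inv, map_inv]
    exact (inv_eq_of_mul_eq_one_right hx).symm
  have hnil : w.toList = [] := by
    by_contra hne
    refine not_nearMat_prod (v := v) (l := w.toList.map g) (by simpa using hne) ?_ ?_ ?_
    · rw [List.isChain_map]
      exact w.chain_ne
    · intro x hx
      obtain ⟨l, hl, rfl⟩ := List.mem_map.1 hx
      exact hletter l.1 l.2 (hmem l hl)
    · rw [hprod, hF]
      exact hnear _
  have hhead : w.head = 1 := by
    apply hinj
    rw [Monoid.PushoutI.NormalWord.prod, map_mul, hbase] at hx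
    simpa [Monoid.CoprodI.Word.prod, hnil] using hx
  simp [Monoid.PushoutI.NormalWord.prod, Monoid.CoprodI.Word.prod, hnil, hhead]

end Amalgam

theorem closure_pair_hom_surjective {G X : Type*} [Group G] [Group X] {a b : G}
    (F : X →* Subgroup.closure {a, b}) {x y : X} (hx : (F x : G) = a) (hy : (F y : G) = b) :
    Function.Surjective F := by
  have h : Subgroup.closure {a, b} ≤ ((Subgroup.closure {a, b}).subtype.comp F).range := by
    rw [Subgroup.closure_le]
    rintro z (rfl | rfl)
    exacts [⟨x, hx⟩, ⟨y, hy⟩]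
  intro z
  obtain ⟨t, ht⟩ := h z.2
  exact ⟨t, Subtype.ext ht⟩

/-- The relations give σ from the presented group to X, and τ ∘ σ fixes the generators, so σ is
injective. Surjectivity onto the closure needs only that a and b are attained. -/
theorem hasPresentation_of_injective {X : Type*} [Group X] {a b : SO3}
    {rels : Set (FreeGroup (Fin 2))}
    (F : X →* Subgroup.closure {a, b}) (hF : Function.Injective F) {x y : X}
    (hx : (F x : SO3) = a) (hy : (F y : SO3) = b)
    (hrels : ∀ r ∈ rels, FreeGroup.lift ![x, y] r = 1)
    (τ : X →* PresentedGroup rels) (hτx : τ x = PresentedGroup.of 0)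
    (hτy : τ y = PresentedGroup.of 1) :
    HasPresentation (Subgroup.closure {a, b}) a b rels := by
  let σ := PresentedGroup.toGroup hrels
  have h0 : σ (PresentedGroup.of 0) = x := PresentedGroup.toGroup.of hrels
  have h1 : σ (PresentedGroup.of 1) = y := PresentedGroup.toGroup.of hrels
  have hleft : τ.comp σ = MonoidHom.id _ := by
    refine PresentedGroup.ext fun i => ?_
    fin_cases i
    · simp [h0, hτx]
    · simp [h1, hτy]
  have hσ : Function.Injective σ := Function.LeftInverse.injective (g := τ)
    fun z => DFunLike.congr_fun hleft z
  have hx' : ((F.comp σ) (PresentedGroup.of 0) : SO3) = a := by simpa [h0] using hx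
  have hy' : ((F.comp σ) (PresentedGroup.of 1) : SO3) = b := by simpa [h1] using hy
  exact ⟨MulEquiv.ofBijective (F.comp σ)
    ⟨hF.comp hσ, closure_pair_hom_surjective _ hx' hy'⟩, hx', hy'⟩

/-! ### The case where 4 divides both p and q. -/

section QuarterTurns

theorem rotY_conj_rotZ (θ : ℝ) :
    rotY (Real.pi / 2) * rotZ θ = rotX θ * rotY (Real.pi / 2) := by
  apply Subtype.ext
  rw [Submonoid.coe_mul, Submonoid.coe_mul]
  ext i j
  fin_cases i <;> fin_cases j <;>
    simp [rotX, rotY, rotZ, Matrix.mul_apply, Fin.sum_univ_three]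

theorem rotX_conj_rotY (θ : ℝ) :
    rotX (Real.pi / 2) * rotY θ = rotZ θ * rotX (Real.pi / 2) := by
  apply Subtype.ext
  rw [Submonoid.coe_mul, Submonoid.coe_mul]
  ext i j
  fin_cases i <;> fin_cases j <;>
    simp [rotX, rotY, rotZ, Matrix.mul_apply, Fin.sum_univ_three]

theorem quarter_mul_angle {p : ℕ} (hp : p ≠ 0) (h : 4 ∣ p) :
    ((p / 4 : ℕ) : ℝ) * (2 * Real.pi / p) = Real.pi / 2 := by
  rw [Nat.cast_div h (by norm_num)]
  field_simp
  push_cast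
  ring

/-- Quarter turns about x and z yield one about y by conjugation, and this one carries rotations
about z to rotations about x. Both groups thus contain the x-rotations by 2π/p and 2π/q, which
generate the x-rotation by 2π/[p,q]. -/
theorem GGroup_eq_GHat {p q : ℕ} (hp : p ≠ 0) (hq : q ≠ 0) (h4p : 4 ∣ p) (h4q : 4 ∣ q) :
    GGroup p q = GHat (Nat.lcm p q) 4 := by
  have hl : Nat.lcm p q ≠ 0 := Nat.lcm_ne_zero hp hq
  have hp' : (p : ℝ) ≠ 0 := mod_cast hp
  have hq' : (q : ℝ) ≠ 0 := mod_cast hq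
  have hl' : (Nat.lcm p q : ℝ) ≠ 0 := mod_cast hl
  have h4 : 2 * Real.pi / ((4 : ℕ) : ℝ) = Real.pi / 2 := by push_cast; ring
  apply le_antisymm
  · have hX : rotX (2 * Real.pi / (Nat.lcm p q : ℕ)) ∈ GHat (Nat.lcm p q) 4 :=
      Subgroup.subset_closure (.inl rfl)
    have hY : rotY (Real.pi / 2) ∈ GHat (Nat.lcm p q) 4 :=
      h4 ▸ Subgroup.subset_closure (.inr rfl)
    have hdvd : ∀ {n : ℕ}, n ≠ 0 → n ∣ Nat.lcm p q →
        rotX (2 * Real.pi / n) ∈ GHat (Nat.lcm p q) 4 := by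
      intro n hn hd
      have hn' : (n : ℝ) ≠ 0 := mod_cast hn
      have := Subgroup.pow_mem _ hX (Nat.lcm p q / n)
      rw [rotX_pow, Nat.cast_div hd hn'] at this
      convert this using 2
      field_simp
    rw [GGroup, Subgroup.closure_le]
    rintro z (rfl | rfl)
    · exact hdvd hp (Nat.dvd_lcm_left p q)
    · have := Subgroup.mul_mem _ (Subgroup.mul_mem _ (Subgroup.inv_mem _ hY)
        (hdvd hq (Nat.dvd_lcm_right p q))) hY
      rwa [mul_assoc, ← rotY_conj_rotZ, inv_mul_cancel_left] at this
  · have hX : rotX (2 * Real.pi / p) ∈ GGroup p q := Subgroup.subset_closure (.inl rfl)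
    have hZ : rotZ (2 * Real.pi / q) ∈ GGroup p q := Subgroup.subset_closure (.inr rfl)
    have hX4 : rotX (Real.pi / 2) ∈ GGroup p q := by
      rw [← quarter_mul_angle hp h4p, ← rotX_pow]
      exact Subgroup.pow_mem _ hX _
    have hZ4 : rotZ (Real.pi / 2) ∈ GGroup p q := by
      rw [← quarter_mul_angle hq h4q, ← rotZ_pow]
      exact Subgroup.pow_mem _ hZ _
    have hY4 : rotY (Real.pi / 2) ∈ GGroup p q := by
      have := Subgroup.mul_mem _ (Subgroup.mul_mem _ (Subgroup.inv_mem _ hX4) hZ4) hX4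
      rwa [mul_assoc, ← rotX_conj_rotY, inv_mul_cancel_left] at this
    have hXq : rotX (2 * Real.pi / q) ∈ GGroup p q := by
      have := Subgroup.mul_mem _ (Subgroup.mul_mem _ hY4 hZ) (Subgroup.inv_mem _ hY4)
      rwa [rotY_conj_rotZ, mul_inv_cancel_right] at this
    rw [GHat, Subgroup.closure_le]
    rintro z (rfl | rfl)
    · have hgl : (Nat.gcd p q : ℝ) * Nat.lcm p q = p * q := mod_cast Nat.gcd_mul_lcm p q
      have hbez : (Nat.gcd p q : ℝ) = p * Nat.gcdA p q + q * Nat.gcdB p q :=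
        mod_cast Nat.gcd_eq_gcd_ab p q
      -- Bézout's identity divided by pq = gcd · lcm; the division exchanges the two coefficients.
      have e : 2 * Real.pi / (Nat.lcm p q : ℕ) =
          Nat.gcdB p q * (2 * Real.pi / p) + Nat.gcdA p q * (2 * Real.pi / q) := by
        field_simp
        rw [← hgl, hbez]
        ring
      rw [e, rotX_add, ← rotX_zpow, ← rotX_zpow]
      exact Subgroup.mul_mem _ (Subgroup.zpow_mem _ hX _) (Subgroup.zpow_mem _ hXq _)
    · rw [h4]
      exact hY4

end QuarterTurns

/-! ### Elements outside the amalgamated subgroup are letters. -/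

section Factors

variable {Γ : Type*} [LinearOrderedCommGroupWithZero Γ]

theorem isLetter_rotX_angle_pow {V : Valuation ℂ Γ} (h2 : V 2 < 1) {p : ℕ} (hp : p ≠ 0) (k : ℕ)
    (hk : ¬ p ∣ 2 * k) :
    IsLetter (V.comap Complex.ofRealHom) false (rotX (2 * Real.pi / p) ^ k : SO3) := by
  rw [rotX_pow]
  refine isLetter_rotX h2 hp ?_ ?_
  · rw [← rotX_pow, ← pow_mul, rotX_angle_pow_eq_one_iff hp]
    exact dvd_mul_left _ _
  · rwa [← rotX_pow, ← pow_mul, Ne, rotX_angle_pow_eq_one_iff hp, mul_comm]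

theorem isLetter_rotZ_angle_pow {V : Valuation ℂ Γ} (h2 : V 2 < 1) {q : ℕ} (hq : q ≠ 0)
    (h4 : ¬ 4 ∣ q) (k : ℕ) (hk : ¬ q ∣ 2 * k) :
    IsLetter (V.comap Complex.ofRealHom) true (rotZ (2 * Real.pi / q) ^ k : SO3) := by
  -- Take m = q/2 for even q, which is odd because 4 ∤ q, and m = q otherwise.
  obtain ⟨m, hm, hd⟩ : ∃ m, Odd m ∧ q ∣ 2 * m := by
    rcases Nat.even_or_odd q with he | ho
    · refine ⟨q / 2, ?_, by rw [Nat.mul_div_cancel' he.two_dvd]⟩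
      rw [Nat.odd_iff]
      have := he.two_dvd
      omega
    · exact ⟨q, ho, dvd_mul_left _ _⟩
  rw [rotZ_pow]
  refine isLetter_rotZ h2 hm ?_ ?_
  · rw [← rotZ_pow, ← pow_mul, rotZ_angle_pow_eq_one_iff hq]
    exact dvd_mul_of_dvd_right hd _
  · rwa [← rotZ_pow, ← pow_mul, Ne, rotZ_angle_pow_eq_one_iff hq, mul_comm]

theorem isLetter_of_notMem_cyc {v : Valuation ℝ Γ} {b : Bool} {n : ℕ} (hn : n ≠ 0)
    (R : Subgroup (Cyc n)) (F : Cyc n →* SO3) (hR : ∀ k, n ∣ 2 * k → cycGen n ^ k ∈ R)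
    (hF : ∀ k : ℕ, ¬ n ∣ 2 * k → IsLetter v b (F (cycGen n) ^ k : SO3)) {t : Cyc n} (ht : t ∉ R) :
    IsLetter v b (F t) := by
  obtain ⟨k, rfl⟩ := cyc_eq_pow hn t
  rw [map_pow]
  exact hF k fun h => ht (hR k h)

/-- R plays the role of the amalgamated subgroup. The reflection acts as 1 modulo 2, so only the
rotation part decides which letter arises. -/
theorem isLetter_of_notMem_dihedral {v : Valuation ℝ Γ} {b : Bool} {n : ℕ} (hn : n ≠ 0)
    (R : Subgroup (DihedralGroup n)) (F : DihedralGroup n →* SO3) (hs : .sr 0 ∈ R)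
    (hR : ∀ k, n ∣ 2 * k → .r 1 ^ k ∈ R) (hnear : NearMat v (F (.sr 0)) 1 1)
    (hF : ∀ k : ℕ, ¬ n ∣ 2 * k → IsLetter v b (F (.r 1) ^ k : SO3))
    {t : DihedralGroup n} (ht : t ∉ R) : IsLetter v b (F t) := by
  obtain ⟨k, rfl | rfl⟩ := dihedral_eq_pow hn t
  · rw [map_pow]
    exact hF k fun h => ht (hR k h)
  · rw [map_mul, map_pow, Submonoid.coe_mul]
    exact hnear.isLetter_mul (hF k fun h => ht (R.mul_mem hs (hR k h)))

end Factors

/-- The relations put the reflection `α ^ (p / 2)` before β, while `dihedralLift` expects the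
rotation first. -/
theorem mul_sq_eq_one_comm {G : Type*} [Group G] {a b : G} (h : (a * b) ^ 2 = 1) :
    (b * a) ^ 2 = 1 := by
  have e : (b * a) ^ 2 = a⁻¹ * (a * b) ^ 2 * a := by simp [sq, mul_assoc]
  rw [e, h, mul_one, inv_mul_cancel]

theorem pow_half_sq {G : Type*} [Monoid G] {a : G} {n : ℕ} (hn : Even n) (h : a ^ n = 1) :
    (a ^ (n / 2)) ^ 2 = 1 := by
  rw [← pow_mul, Nat.div_mul_cancel hn.two_dvd, h]

/-- The powers that are not letters are those with n ∣ 2k, that is, multiples of n/2; these must lie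
in the amalgamated subgroup. -/
theorem pow_mem_of_even {G : Type*} [Group G] (R : Subgroup G) {a : G} {n : ℕ} (hn : Even n)
    (h : a ^ (n / 2) ∈ R) {k : ℕ} (hk : n ∣ 2 * k) : a ^ k ∈ R := by
  obtain ⟨m, rfl⟩ : n / 2 ∣ k := by
    rw [← Nat.div_mul_cancel hn.two_dvd, mul_comm] at hk
    exact Nat.dvd_of_mul_dvd_mul_left two_pos hk
  rw [pow_mul]
  exact R.pow_mem h m

theorem pow_mem_of_odd {G : Type*} [Group G] (R : Subgroup G) {a : G} {n : ℕ} (hn : Odd n)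
    (h : a ^ n = 1) {k : ℕ} (hk : n ∣ 2 * k) : a ^ k ∈ R := by
  obtain ⟨m, rfl⟩ := (Nat.Coprime.dvd_mul_left hn.coprime_two_right).1 hk
  rw [pow_mul, h, one_pow]
  exact R.one_mem

/-! ### The generators of G(p,q) and their relations. -/

section Generators

/-- The rotation about the `x`-axis that generates `G(p,q)`, as an element of `G(p,q)`. -/
noncomputable def genX (p q : ℕ) : GGroup p q :=
  ⟨rotX (2 * Real.pi / p), Subgroup.subset_closure (.inl rfl)⟩

/-- The rotation about the `z`-axis that generates `G(p,q)`, as an element of `G(p,q)`. -/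
noncomputable def genZ (p q : ℕ) : GGroup p q :=
  ⟨rotZ (2 * Real.pi / q), Subgroup.subset_closure (.inr rfl)⟩

variable {p q : ℕ}

theorem genX_pow (hp : p ≠ 0) : genX p q ^ p = 1 :=
  Subtype.ext ((rotX_angle_pow_eq_one_iff hp p).2 dvd_rfl)

theorem genZ_pow (hq : q ≠ 0) : genZ p q ^ q = 1 :=
  Subtype.ext ((rotZ_angle_pow_eq_one_iff hq q).2 dvd_rfl)

theorem coe_genX_pow_half (hp : p ≠ 0) (h : Even p) :
    ((genX p q ^ (p / 2) : GGroup p q) : SO3) = rotX Real.pi :=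
  rotX_angle_pow_half hp h

theorem coe_genZ_pow_half (hq : q ≠ 0) (h : Even q) :
    ((genZ p q ^ (q / 2) : GGroup p q) : SO3) = rotZ Real.pi :=
  rotZ_angle_pow_half hq h

theorem genX_pow_half_mul_genZ_sq (hp : p ≠ 0) (h : Even p) :
    (genX p q ^ (p / 2) * genZ p q) ^ 2 = 1 := by
  apply Subtype.ext
  rw [SubmonoidClass.coe_pow, Subgroup.coe_mul, coe_genX_pow_half hp h]
  exact rotX_pi_mul_rotZ_sq _

theorem genX_mul_genZ_pow_half_sq (hq : q ≠ 0) (h : Even q) :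
    (genX p q * genZ p q ^ (q / 2)) ^ 2 = 1 := by
  apply Subtype.ext
  rw [SubmonoidClass.coe_pow, Subgroup.coe_mul, coe_genZ_pow_half hq h]
  exact rotX_mul_rotZ_pi_sq _

end Generators

/-! ### The three structure theorems. -/

section Main

open Monoid

variable {p q : ℕ}

/-- The homomorphism `ℤ_p * ℤ_q → G(p,q)`. -/
noncomputable def coprodHom (hp : p ≠ 0) (hq : q ≠ 0) : Coprod (Cyc p) (Cyc q) →* GGroup p q :=
  Coprod.lift (cycLift (genX p q) (genX_pow hp)) (cycLift (genZ p q) (genZ_pow hq))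

/-- The free product is treated as an amalgam over the trivial group, into which it embeds because J
has a left inverse. -/
theorem coprodHom_injective (hp : p ≠ 0) (hq : q ≠ 0) (hpo : Odd p) (hqo : Odd q) :
    Function.Injective (coprodHom hp hq) := by
  obtain ⟨B, hB⟩ := exists_valuationSubring_two_lt_one
  let φ : PUnit.{1} →* Cyc p := 1
  let ψ : PUnit.{1} →* Cyc q := 1
  let F : Amalgam φ ψ →* GGroup p q :=
    Amalgam.desc (cycLift (genX p q) (genX_pow hp)) (cycLift (genZ p q) (genZ_pow hq))
      (by simp [φ, ψ])
  have hF : Function.Injective ((GGroup p q).subtype.comp F) := by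
    refine Amalgam.injective_of_isLetter (v := B.valuation.comap Complex.ofRealHom)
      (Function.injective_of_subsingleton _) (Function.injective_of_subsingleton _) _
      (fun _ _ => rfl) (fun h => ?_) (fun t ht => ?_) fun t ht => ?_
    · rw [MonoidHom.one_apply, map_one, map_one]
      exact nearMat_one_one _
    · refine isLetter_of_notMem_cyc hp φ.range
        (((GGroup p q).subtype.comp F).comp (Amalgam.inl φ ψ))
        (fun k hk => pow_mem_of_odd _ hpo (cycGen_pow_self p) hk) (fun k hk => ?_) ht
      simpa [F, genX] using isLetter_rotX_angle_pow hB hp k hk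
    · refine isLetter_of_notMem_cyc hq ψ.range
        (((GGroup p q).subtype.comp F).comp (Amalgam.inr φ ψ))
        (fun k hk => pow_mem_of_odd _ hqo (cycGen_pow_self q) hk) (fun k hk => ?_) ht
      have h4 : ¬ 4 ∣ q := fun h => Nat.not_even_iff_odd.2 hqo
        (even_iff_two_dvd.2 ((by norm_num : 2 ∣ 4).trans h))
      simpa [F, genZ] using isLetter_rotZ_angle_pow hB hq h4 k hk
  let J : Coprod (Cyc p) (Cyc q) →* Amalgam φ ψ :=
    Coprod.lift (Amalgam.inl φ ψ) (Amalgam.inr φ ψ)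
  let J' : Amalgam φ ψ →* Coprod (Cyc p) (Cyc q) :=
    Amalgam.desc Coprod.inl Coprod.inr (by simp [φ, ψ])
  have hJ : J'.comp J = MonoidHom.id _ := by
    refine Coprod.hom_ext ?_ ?_ <;> refine MonoidHom.ext fun x => ?_ <;> simp [J, J']
  have hJinj : Function.Injective J :=
    Function.LeftInverse.injective (g := J') fun z => DFunLike.congr_fun hJ z
  have e : coprodHom hp hq = F.comp J := by
    refine Coprod.hom_ext ?_ ?_ <;> refine MonoidHom.ext fun x => ?_ <;> simp [coprodHom, F, J]
  rw [e]
  exact (Function.Injective.of_comp (f := (GGroup p q).subtype) hF).comp hJinj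

theorem presentedGroup_relation {rels : Set (FreeGroup (Fin 2))} {r : FreeGroup (Fin 2)}
    (h : r ∈ rels) : PresentedGroup.mk rels r = 1 :=
  PresentedGroup.one_of_mem h

theorem odd_odd_structure (hp : p ≠ 0) (hq : q ≠ 0) (hpo : Odd p) (hqo : Odd q) :
    HasPresentation (GGroup p q) (genX p q) (genZ p q) {genα ^ p, genβ ^ q} ∧
      ∃ e : Coprod (Cyc p) (Cyc q) ≃* GGroup p q,
        (e (Coprod.inl (cycGen p)) : SO3) = genX p q ∧
        (e (Coprod.inr (cycGen q)) : SO3) = genZ p q := by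
  have hinj := coprodHom_injective hp hq hpo hqo
  have hx : (coprodHom hp hq (Coprod.inl (cycGen p)) : SO3) = genX p q := by simp [coprodHom]
  have hy : (coprodHom hp hq (Coprod.inr (cycGen q)) : SO3) = genZ p q := by simp [coprodHom]
  refine ⟨?_, MulEquiv.ofBijective _ ⟨hinj, closure_pair_hom_surjective _ hx hy⟩, hx, hy⟩
  set rels : Set (FreeGroup (Fin 2)) := {genα ^ p, genβ ^ q}
  have hα : (PresentedGroup.of 0 : PresentedGroup rels) ^ p = 1 :=
    presentedGroup_relation (r := genα ^ p) (.inl rfl)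
  have hβ : (PresentedGroup.of 1 : PresentedGroup rels) ^ q = 1 :=
    presentedGroup_relation (r := genβ ^ q) (.inr rfl)
  refine hasPresentation_of_injective _ hinj hx hy ?_
    (Coprod.lift (cycLift _ hα) (cycLift _ hβ)) (by simp) (by simp)
  -- Injectivity reduces the relations to identities in G(p,q).
  rintro r (rfl | rfl) <;> apply hinj
  · simp [genα, coprodHom, genX_pow hp]
  · simp [genβ, coprodHom, genZ_pow hq]

theorem sr_zero_sq (n : ℕ) : (DihedralGroup.sr 0 : DihedralGroup n) ^ 2 = 1 := by
  rw [sq, DihedralGroup.sr_mul_self]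

theorem dihedral_sr_ne_one {n : ℕ} (i : ZMod n) : DihedralGroup.sr i ≠ 1 := by
  rw [DihedralGroup.one_def]
  exact nofun

theorem even_odd_structure (hp : p ≠ 0) (hq : q ≠ 0) (hpe : Even p) (hqo : Odd q) :
    HasPresentation (GGroup p q) (genX p q) (genZ p q)
        {genα ^ p, genβ ^ q, (genα ^ (p / 2) * genβ) ^ 2} ∧
      ∃ (φ : Cyc 2 →* Cyc p) (ψ : Cyc 2 →* DihedralGroup q),
        Function.Injective φ ∧ Function.Injective ψ ∧
        φ (cycGen 2) = cycGen p ^ (p / 2) ∧ ψ (cycGen 2) = DihedralGroup.sr 0 ∧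
        ∃ e : Amalgam φ ψ ≃* GGroup p q,
          (e (Amalgam.inl φ ψ (cycGen p)) : SO3) = genX p q ∧
          (e (Amalgam.inr φ ψ (DihedralGroup.r 1)) : SO3) = genZ p q ∧
          (e (Amalgam.inr φ ψ (DihedralGroup.sr 0)) : SO3) = (genX p q : SO3) ^ (p / 2) := by
  obtain ⟨B, hB⟩ := exists_valuationSubring_two_lt_one
  let φ : Cyc 2 →* Cyc p := cycLift (cycGen p ^ (p / 2)) (pow_half_sq hpe (cycGen_pow_self p))
  let ψ : Cyc 2 →* DihedralGroup q := cycLift (.sr 0) (sr_zero_sq q)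
  have hφ1 : φ (cycGen 2) = cycGen p ^ (p / 2) := cycLift_cycGen _ _
  have hψ1 : ψ (cycGen 2) = .sr 0 := cycLift_cycGen _ _
  have hφ : Function.Injective φ := Cyc.hom_two_injective _ (by
    rw [hφ1, Ne, cycGen_pow_eq_one_iff]
    have := hpe.two_dvd
    exact Nat.not_dvd_of_pos_of_lt (by omega) (by omega))
  have hψ : Function.Injective ψ := Cyc.hom_two_injective _ (hψ1.trans_ne (dihedral_sr_ne_one 0))
  have hX := genX_pow (q := q) hp
  have hZ := genZ_pow (p := p) hq
  let f : Cyc p →* GGroup p q := cycLift (genX p q) hX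
  let g : DihedralGroup q →* GGroup p q := dihedralLift (genZ p q) (genX p q ^ (p / 2)) hZ
    (pow_half_sq hpe hX) (mul_sq_eq_one_comm (genX_pow_half_mul_genZ_sq hp hpe))
  have hfg : ∀ x, f (φ x) = g (ψ x) := by
    have : f.comp φ = g.comp ψ := Cyc.hom_ext (by simp [hφ1, hψ1, f, g])
    exact fun x => DFunLike.congr_fun this x
  let F : Amalgam φ ψ →* GGroup p q := Amalgam.desc f g hfg
  have hbase : ((F (Amalgam.inl φ ψ (φ (cycGen 2))) : GGroup p q) : SO3) = rotX Real.pi := by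
    rw [hφ1, Amalgam.desc_inl, map_pow, cycLift_cycGen, coe_genX_pow_half hp hpe]
  have hF : Function.Injective ((GGroup p q).subtype.comp F) := by
    refine Amalgam.injective_of_isLetter (v := B.valuation.comap Complex.ofRealHom) hφ hψ _
      (fun h h1 => ?_) (fun h => ?_) (fun t ht => ?_) fun t ht => ?_
    · rcases cyc_two_eq h with rfl | rfl
      · rfl
      · exact absurd (hbase.symm.trans h1) rotX_pi_ne_one
    · rcases cyc_two_eq h with rfl | rfl
      · rw [map_one, map_one, map_one]
        exact nearMat_one_one _
      · rw [MonoidHom.comp_apply, Subgroup.subtype_apply, hbase]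
        exact nearMat_rotX_pi hB
    · refine isLetter_of_notMem_cyc hp φ.range
        (((GGroup p q).subtype.comp F).comp (Amalgam.inl φ ψ))
        (fun k hk => pow_mem_of_even φ.range hpe ⟨_, hφ1⟩ hk) (fun k hk => ?_) ht
      simpa [F, f, genX] using isLetter_rotX_angle_pow hB hp k hk
    · refine isLetter_of_notMem_dihedral hq ψ.range
        (((GGroup p q).subtype.comp F).comp (Amalgam.inr φ ψ)) ⟨_, hψ1⟩
        (fun k hk => pow_mem_of_odd _ hqo DihedralGroup.r_one_pow_n hk) ?_ (fun k hk => ?_) ht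
      · rw [MonoidHom.comp_apply, ← hψ1, ← Amalgam.inl_apply_eq_inr_apply, MonoidHom.comp_apply,
          Subgroup.subtype_apply, hbase]
        exact nearMat_rotX_pi hB
      · have h4 : ¬ 4 ∣ q := fun h => Nat.not_even_iff_odd.2 hqo
          (even_iff_two_dvd.2 ((by norm_num : 2 ∣ 4).trans h))
        simpa [F, g, genZ] using isLetter_rotZ_angle_pow hB hq h4 k hk
  have hinj : Function.Injective F := Function.Injective.of_comp (f := (GGroup p q).subtype) hF
  have hx : (F (Amalgam.inl φ ψ (cycGen p)) : SO3) = genX p q := by simp [F, f]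
  have hy : (F (Amalgam.inr φ ψ (.r 1)) : SO3) = genZ p q := by simp [F, g]
  have hs : (F (Amalgam.inr φ ψ (.sr 0)) : SO3) = (genX p q : SO3) ^ (p / 2) := by simp [F, g]
  refine ⟨?_, φ, ψ, hφ, hψ, hφ1, hψ1,
    MulEquiv.ofBijective F ⟨hinj, closure_pair_hom_surjective _ hx hy⟩, hx, hy, hs⟩
  · set rels : Set (FreeGroup (Fin 2)) := {genα ^ p, genβ ^ q, (genα ^ (p / 2) * genβ) ^ 2}
    have hα : (PresentedGroup.of 0 : PresentedGroup rels) ^ p = 1 :=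
      presentedGroup_relation (r := genα ^ p) (.inl rfl)
    have hβ : (PresentedGroup.of 1 : PresentedGroup rels) ^ q = 1 :=
      presentedGroup_relation (r := genβ ^ q) (.inr (.inl rfl))
    have hαβ : ((PresentedGroup.of 0 : PresentedGroup rels) ^ (p / 2) *
        PresentedGroup.of 1) ^ 2 = 1 :=
      presentedGroup_relation (r := (genα ^ (p / 2) * genβ) ^ 2) (.inr (.inr rfl))
    let f' : Cyc p →* PresentedGroup rels := cycLift _ hα
    let g' : DihedralGroup q →* PresentedGroup rels :=
      dihedralLift _ _ hβ (pow_half_sq hpe hα) (mul_sq_eq_one_comm hαβ)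
    have hfg' : ∀ x, f' (φ x) = g' (ψ x) := by
      have : f'.comp φ = g'.comp ψ := Cyc.hom_ext (by simp [hφ1, hψ1, f', g'])
      exact fun x => DFunLike.congr_fun this x
    refine hasPresentation_of_injective F hinj hx hy ?_ (Amalgam.desc f' g' hfg')
      (by simp [f']) (by simp [g'])
    rintro r (rfl | rfl | rfl) <;> apply hinj
    · simp [genα, F, f, hX]
    · simp [genβ, F, g, hZ]
    · simp [genα, genβ, F, f, g, genX_pow_half_mul_genZ_sq hp hpe]

theorem even_even_structure (hp : p ≠ 0) (hq : q ≠ 0) (hpe : Even p) (hqe : Even q)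
    (h4 : ¬ 4 ∣ q) :
    HasPresentation (GGroup p q) (genX p q) (genZ p q)
        {genα ^ p, genβ ^ q, (genα ^ (p / 2) * genβ) ^ 2, (genα * genβ ^ (q / 2)) ^ 2} ∧
      ∃ (φ : DihedralGroup 2 →* DihedralGroup p) (ψ : DihedralGroup 2 →* DihedralGroup q),
        Function.Injective φ ∧ Function.Injective ψ ∧
        φ (DihedralGroup.r 1) = DihedralGroup.r 1 ^ (p / 2) ∧
        φ (DihedralGroup.sr 0) = DihedralGroup.sr 0 ∧
        ψ (DihedralGroup.r 1) = DihedralGroup.sr 0 ∧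
        ψ (DihedralGroup.sr 0) = DihedralGroup.r 1 ^ (q / 2) ∧
        ∃ e : Amalgam φ ψ ≃* GGroup p q,
          (e (Amalgam.inl φ ψ (DihedralGroup.r 1)) : SO3) = genX p q ∧
          (e (Amalgam.inl φ ψ (DihedralGroup.sr 0)) : SO3) = (genZ p q : SO3) ^ (q / 2) ∧
          (e (Amalgam.inr φ ψ (DihedralGroup.r 1)) : SO3) = genZ p q ∧
          (e (Amalgam.inr φ ψ (DihedralGroup.sr 0)) : SO3) = (genX p q : SO3) ^ (p / 2) := by
  obtain ⟨B, hB⟩ := exists_valuationSubring_two_lt_one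
  let φ : DihedralGroup 2 →* DihedralGroup p :=
    dihedralLift (.r 1 ^ (p / 2)) (.sr 0) (pow_half_sq hpe DihedralGroup.r_one_pow_n)
      (sr_zero_sq p) (by simp [sq])
  -- The roles are exchanged relative to φ: the half turn about x is a rotation in D_p but a
  -- reflection in D_q, and the half turn about z the reverse.
  let ψ : DihedralGroup 2 →* DihedralGroup q :=
    dihedralLift (.sr 0) (.r 1 ^ (q / 2)) (sr_zero_sq q)
      (pow_half_sq hqe DihedralGroup.r_one_pow_n) (by simp [sq])
  have hφr : φ (.r 1) = .r 1 ^ (p / 2) := dihedralLift_r_one _ _ _ _ _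
  have hφs : φ (.sr 0) = .sr 0 := dihedralLift_sr_zero _ _ _ _ _
  have hψr : ψ (.r 1) = .sr 0 := dihedralLift_r_one _ _ _ _ _
  have hψs : ψ (.sr 0) = .r 1 ^ (q / 2) := dihedralLift_sr_zero _ _ _ _ _
  have hhalf : ∀ {n : ℕ}, n ≠ 0 → Even n → (.r 1 : DihedralGroup n) ^ (n / 2) ≠ 1 := by
    intro n hn he
    have := he.two_dvd
    exact pow_ne_one_of_lt_orderOf (by omega) (by rw [DihedralGroup.orderOf_r_one]; omega)
  have hφ : Function.Injective φ := DihedralGroup.hom_two_injective _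
    (by rw [hφr]; exact hhalf hp hpe)
    (hφs.trans_ne (dihedral_sr_ne_one 0))
    (by
        rw [hφr, hφs, DihedralGroup.r_one_pow, DihedralGroup.sr_mul_r]
        exact dihedral_sr_ne_one _)
  have hψ : Function.Injective ψ := DihedralGroup.hom_two_injective _
    (hψr.trans_ne (dihedral_sr_ne_one 0))
    (by rw [hψs]; exact hhalf hq hqe)
    (by
        rw [hψr, hψs, DihedralGroup.r_one_pow, DihedralGroup.r_mul_sr]
        exact dihedral_sr_ne_one _)
  have hX := genX_pow (q := q) hp
  have hZ := genZ_pow (p := p) hq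
  let f : DihedralGroup p →* GGroup p q := dihedralLift (genX p q) (genZ p q ^ (q / 2)) hX
    (pow_half_sq hqe hZ) (genX_mul_genZ_pow_half_sq hq hqe)
  let g : DihedralGroup q →* GGroup p q := dihedralLift (genZ p q) (genX p q ^ (p / 2)) hZ
    (pow_half_sq hpe hX) (mul_sq_eq_one_comm (genX_pow_half_mul_genZ_sq hp hpe))
  have hfg : ∀ x, f (φ x) = g (ψ x) := by
    have : f.comp φ = g.comp ψ := DihedralGroup.hom_ext
      (by simp only [MonoidHom.comp_apply, hφr, hψr, f, g, map_pow, dihedralLift_r_one,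
        dihedralLift_sr_zero])
      (by simp only [MonoidHom.comp_apply, hφs, hψs, f, g, map_pow, dihedralLift_r_one,
        dihedralLift_sr_zero])
    exact fun x => DFunLike.congr_fun this x
  let F : Amalgam φ ψ →* GGroup p q := Amalgam.desc f g hfg
  have hbr : ((F (Amalgam.inl φ ψ (φ (.r 1))) : GGroup p q) : SO3) = rotX Real.pi := by
    rw [hφr, Amalgam.desc_inl, map_pow, dihedralLift_r_one, coe_genX_pow_half hp hpe]
  have hbs : ((F (Amalgam.inl φ ψ (φ (.sr 0))) : GGroup p q) : SO3) = rotZ Real.pi := by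
    rw [hφs, Amalgam.desc_inl, dihedralLift_sr_zero, coe_genZ_pow_half hq hqe]
  have hF : Function.Injective ((GGroup p q).subtype.comp F) := by
    refine Amalgam.injective_of_isLetter (v := B.valuation.comap Complex.ofRealHom) hφ hψ _
      ?_ (fun h => ?_) (fun t ht => ?_) fun t ht => ?_
    · have := DihedralGroup.hom_two_injective
        ((((GGroup p q).subtype.comp F).comp (Amalgam.inl φ ψ)).comp φ)
        (hbr.trans_ne rotX_pi_ne_one) (hbs.trans_ne rotZ_pi_ne_one)
        ((congrArg₂ (· * ·) hbs hbr).trans_ne rotZ_pi_mul_rotX_pi_ne_one)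
      exact (injective_iff_map_eq_one _).1 this
    · rcases dihedral_two_eq h with rfl | rfl | rfl | rfl
      · rw [map_one, map_one, map_one]
        exact nearMat_one_one _
      · rw [MonoidHom.comp_apply, Subgroup.subtype_apply, hbr]
        exact nearMat_rotX_pi hB
      · rw [MonoidHom.comp_apply, Subgroup.subtype_apply, hbs]
        exact nearMat_rotZ_pi hB
      · rw [MonoidHom.comp_apply, Subgroup.subtype_apply, map_mul, map_mul, map_mul,
          Subgroup.coe_mul, hbr, hbs]
        exact (nearMat_rotZ_pi hB).mul_one_one (nearMat_rotX_pi hB)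
    · refine isLetter_of_notMem_dihedral hp φ.range
        (((GGroup p q).subtype.comp F).comp (Amalgam.inl φ ψ)) ⟨_, hφs⟩
        (fun k hk => pow_mem_of_even φ.range hpe ⟨_, hφr⟩ hk) ?_ (fun k hk => ?_) ht
      · rw [MonoidHom.comp_apply, ← hφs, MonoidHom.comp_apply, Subgroup.subtype_apply, hbs]
        exact nearMat_rotZ_pi hB
      · simpa [F, f, genX] using isLetter_rotX_angle_pow hB hp k hk
    · refine isLetter_of_notMem_dihedral hq ψ.range
        (((GGroup p q).subtype.comp F).comp (Amalgam.inr φ ψ)) ⟨_, hψr⟩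
        (fun k hk => pow_mem_of_even ψ.range hqe ⟨_, hψs⟩ hk) ?_ (fun k hk => ?_) ht
      · rw [MonoidHom.comp_apply, ← hψr, ← Amalgam.inl_apply_eq_inr_apply, MonoidHom.comp_apply,
          Subgroup.subtype_apply, hbr]
        exact nearMat_rotX_pi hB
      · simpa [F, g, genZ] using isLetter_rotZ_angle_pow hB hq h4 k hk
  have hinj : Function.Injective F := Function.Injective.of_comp (f := (GGroup p q).subtype) hF
  have hx : (F (Amalgam.inl φ ψ (.r 1)) : SO3) = genX p q := by simp [F, f]
  have hy : (F (Amalgam.inr φ ψ (.r 1)) : SO3) = genZ p q := by simp [F, g]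
  have hs : (F (Amalgam.inr φ ψ (.sr 0)) : SO3) = (genX p q : SO3) ^ (p / 2) := by simp [F, g]
  have ht : (F (Amalgam.inl φ ψ (.sr 0)) : SO3) = (genZ p q : SO3) ^ (q / 2) := by simp [F, f]
  refine ⟨?_, φ, ψ, hφ, hψ, hφr, hφs, hψr, hψs,
    MulEquiv.ofBijective F ⟨hinj, closure_pair_hom_surjective _ hx hy⟩, hx, ht, hy, hs⟩
  · set rels : Set (FreeGroup (Fin 2)) :=
      {genα ^ p, genβ ^ q, (genα ^ (p / 2) * genβ) ^ 2, (genα * genβ ^ (q / 2)) ^ 2}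
    have hα : (PresentedGroup.of 0 : PresentedGroup rels) ^ p = 1 :=
      presentedGroup_relation (r := genα ^ p) (.inl rfl)
    have hβ : (PresentedGroup.of 1 : PresentedGroup rels) ^ q = 1 :=
      presentedGroup_relation (r := genβ ^ q) (.inr (.inl rfl))
    have hαβ : ((PresentedGroup.of 0 : PresentedGroup rels) ^ (p / 2) *
        PresentedGroup.of 1) ^ 2 = 1 :=
      presentedGroup_relation (r := (genα ^ (p / 2) * genβ) ^ 2) (.inr (.inr (.inl rfl)))
    have hαβ' : ((PresentedGroup.of 0 : PresentedGroup rels) *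
        PresentedGroup.of 1 ^ (q / 2)) ^ 2 = 1 :=
      presentedGroup_relation (r := (genα * genβ ^ (q / 2)) ^ 2) (.inr (.inr (.inr rfl)))
    let f' : DihedralGroup p →* PresentedGroup rels :=
      dihedralLift _ _ hα (pow_half_sq hqe hβ) hαβ'
    let g' : DihedralGroup q →* PresentedGroup rels :=
      dihedralLift _ _ hβ (pow_half_sq hpe hα) (mul_sq_eq_one_comm hαβ)
    have hfg' : ∀ x, f' (φ x) = g' (ψ x) := by
      have : f'.comp φ = g'.comp ψ := DihedralGroup.hom_ext
        (by simp only [MonoidHom.comp_apply, hφr, hψr, f', g', map_pow, dihedralLift_r_one,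
          dihedralLift_sr_zero])
        (by simp only [MonoidHom.comp_apply, hφs, hψs, f', g', map_pow, dihedralLift_r_one,
          dihedralLift_sr_zero])
      exact fun x => DFunLike.congr_fun this x
    refine hasPresentation_of_injective F hinj hx hy ?_ (Amalgam.desc f' g' hfg')
      (by simp [f']) (by simp [g'])
    rintro r (rfl | rfl | rfl | rfl) <;> apply hinj
    · simp [genα, F, f, g, hX]
    · simp [genβ, F, f, g, hZ]
    · simp [genα, genβ, F, f, g, genX_pow_half_mul_genZ_sq hp hpe]
    · simp [genα, genβ, F, f, g, genX_mul_genZ_pow_half_sq hq hqe]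

end Main

theorem theorem2 (p q : ℕ) (hp : 0 < p) (hq : 0 < q)
    (A C : SO3) (hA : A = rotX (2 * Real.pi / p)) (hC : C = rotZ (2 * Real.pi / q)) :
    -- Case 1
    (Odd p → Odd q →
      HasPresentation (GGroup p q) A C {genα ^ p, genβ ^ q} ∧
      ∃ e : Monoid.Coprod (Cyc p) (Cyc q) ≃* GGroup p q,
        (e (Monoid.Coprod.inl (cycGen p)) : SO3) = A ∧
        (e (Monoid.Coprod.inr (cycGen q)) : SO3) = C) ∧
    -- Case 2
    (Even p → Odd q →
      HasPresentation (GGroup p q) A C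
        {genα ^ p, genβ ^ q, (genα ^ (p / 2) * genβ) ^ 2} ∧
      ∃ (φ : Cyc 2 →* Cyc p) (ψ : Cyc 2 →* DihedralGroup q),
        Function.Injective φ ∧ Function.Injective ψ ∧
        φ (cycGen 2) = cycGen p ^ (p / 2) ∧ ψ (cycGen 2) = DihedralGroup.sr 0 ∧
        ∃ e : Amalgam φ ψ ≃* GGroup p q,
          (e (Amalgam.inl φ ψ (cycGen p)) : SO3) = A ∧
          (e (Amalgam.inr φ ψ (DihedralGroup.r 1)) : SO3) = C ∧
          (e (Amalgam.inr φ ψ (DihedralGroup.sr 0)) : SO3) = A ^ (p / 2)) ∧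
    -- Case 3
    (Even p → Even q → ¬ 4 ∣ q →
      HasPresentation (GGroup p q) A C
        {genα ^ p, genβ ^ q, (genα ^ (p / 2) * genβ) ^ 2, (genα * genβ ^ (q / 2)) ^ 2} ∧
      ∃ (φ : DihedralGroup 2 →* DihedralGroup p) (ψ : DihedralGroup 2 →* DihedralGroup q),
        Function.Injective φ ∧ Function.Injective ψ ∧
        φ (DihedralGroup.r 1) = DihedralGroup.r 1 ^ (p / 2) ∧
        φ (DihedralGroup.sr 0) = DihedralGroup.sr 0 ∧
        ψ (DihedralGroup.r 1) = DihedralGroup.sr 0 ∧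
        ψ (DihedralGroup.sr 0) = DihedralGroup.r 1 ^ (q / 2) ∧
        ∃ e : Amalgam φ ψ ≃* GGroup p q,
          (e (Amalgam.inl φ ψ (DihedralGroup.r 1)) : SO3) = A ∧
          (e (Amalgam.inl φ ψ (DihedralGroup.sr 0)) : SO3) = C ^ (q / 2) ∧
          (e (Amalgam.inr φ ψ (DihedralGroup.r 1)) : SO3) = C ∧
          (e (Amalgam.inr φ ψ (DihedralGroup.sr 0)) : SO3) = A ^ (p / 2)) ∧
    -- Case 4
    (4 ∣ p → 4 ∣ q → GGroup p q = GHat (Nat.lcm p q) 4) := by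
  subst hA hC
  exact ⟨odd_odd_structure hp.ne' hq.ne', even_odd_structure hp.ne' hq.ne',
    even_even_structure hp.ne' hq.ne', GGroup_eq_GHat hp.ne' hq.ne'⟩
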